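/- Let $n\ge 3$ and let $(M^n,g)$ be a complete, noncompact, connected smooth Riemannian manifold without boundary, with distance function $d$ and Riemannian measure $dv_g$. Let $$A_g=\frac{1}{n-2}\Bigl(\mathrm{Ric}_g-\frac{R_g}{2(n-1)}\,g\Bigr)$$ be its Schouten tensor and, for $0\le k\le n$, let $\sigma_k$ be the $k$-th elementary symmetric function of the eigenvalues of $g^{-1}A_g$ (with $\sigma_0=1$). Let $k,l\in\{0,\dots,n\}$, let $X$ be a smooth vector field and $\lambda$ a smooth function on $M$ such that $(M^n,g,X,\lambda)$ is a quotient almost Yamabe soliton, i.e. $$\tfrac12\mathcal{L}_Xg=\Bigl(\log\frac{\sigma_k}{\sigma_l}-\lambda\Bigr)g\quad\text{and}\quad \sigma_k\cdot\sigma_l>0\quad\text{on } M.$$ Suppose that for some $x_0\in M$ and some $r>0$ $$\int_{M\setminus B_r(x_0)}\frac{|X|}{d(x,x_0)}\,dv_g<\infty\qquad\text{and}\qquad \mathcal{L}_Xg\ge 0 .$$ Then the soliton is trivial, that is, $\mathcal{L}_Xg=0$ and $\log\frac{\sigma_k}{\sigma_l}-\lambda=0$ on $M$. -/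

import Mathlib

open MeasureTheory Bundle
open scoped Manifold ContDiff ENNReal

noncomputable section

/-! Riemannian geometry of an `n`-manifold `M` (modelled on `EuclideanSpace ℝ (Fin n)`, without
boundary), whose Riemannian metric is the inner product on its tangent spaces. Coordinate
expressions are taken in the preferred chart around a point `p`, and are functions on the model
space that are meaningful on the target of that chart. -/

section Coordinates

variable {n : ℕ} {M : Type*} [TopologicalSpace M] [ChartedSpace (EuclideanSpace ℝ (Fin n)) M]

/-- The coordinate vector field `∂ᵢ` of the chart around `p`, at the point with coordinates `y`. -/
def coordField (p : M) (i : Fin n) (y : EuclideanSpace ℝ (Fin n)) :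
    TangentSpace (𝓡 n) ((extChartAt (𝓡 n) p).symm y) :=
  mfderiv 𝓘(ℝ, EuclideanSpace ℝ (Fin n)) (𝓡 n) (extChartAt (𝓡 n) p).symm y
    (EuclideanSpace.single i (1 : ℝ))

/-- Partial derivative in the `i`-th coordinate direction of the model space. -/
def partialDeriv (i : Fin n) (f : EuclideanSpace ℝ (Fin n) → ℝ)
    (y : EuclideanSpace ℝ (Fin n)) : ℝ :=
  fderiv ℝ f y (EuclideanSpace.single i (1 : ℝ))

variable [RiemannianBundle (fun x : M => TangentSpace (𝓡 n) x)]

/-- The matrix `g_{ij} = g(∂ᵢ, ∂ⱼ)` of the metric in the chart around `p`. -/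
def metricMatrix (p : M) (y : EuclideanSpace ℝ (Fin n)) : Matrix (Fin n) (Fin n) ℝ :=
  Matrix.of fun i j => inner ℝ (coordField p i y) (coordField p j y)

/-- The Christoffel symbols
`Γ^c_{ab} = ½ ∑_d g^{cd} (∂_a g_{bd} + ∂_b g_{ad} - ∂_d g_{ab})`. -/
def christoffel (p : M) (c a b : Fin n) (y : EuclideanSpace ℝ (Fin n)) : ℝ :=
  1 / 2 * ∑ d, (metricMatrix p y)⁻¹ c d *
    (partialDeriv a (fun z => metricMatrix p z b d) y
      + partialDeriv b (fun z => metricMatrix p z a d) y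
      - partialDeriv d (fun z => metricMatrix p z a b) y)

/-- The Ricci tensor in coordinates:
`Ric_{ij} = ∑_k (∂_k Γ^k_{ij} - ∂_j Γ^k_{ik}) + ∑_{k,m} (Γ^k_{km} Γ^m_{ij} - Γ^k_{jm} Γ^m_{ik})`. -/
def ricciMatrix (p : M) (y : EuclideanSpace ℝ (Fin n)) : Matrix (Fin n) (Fin n) ℝ :=
  Matrix.of fun i j =>
    ∑ k, (partialDeriv k (christoffel p k i j) y - partialDeriv j (christoffel p k i k) y)
      + ∑ k, ∑ m, (christoffel p k k m y * christoffel p m i j y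
          - christoffel p k j m y * christoffel p m i k y)

/-- The scalar curvature `R = ∑_{i,j} g^{ij} Ric_{ij}` in coordinates. -/
def scalarCoord (p : M) (y : EuclideanSpace ℝ (Fin n)) : ℝ :=
  ∑ i, ∑ j, (metricMatrix p y)⁻¹ i j * ricciMatrix p y i j

/-- The Schouten tensor `A = (1/(n-2)) (Ric - R/(2(n-1)) g)` in coordinates (for `3 ≤ n`). -/
def schoutenMatrix (p : M) (y : EuclideanSpace ℝ (Fin n)) : Matrix (Fin n) (Fin n) ℝ :=
  (1 / ((n : ℝ) - 2)) •
    (ricciMatrix p y - (scalarCoord p y / (2 * ((n : ℝ) - 1))) • metricMatrix p y)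

/-- The matrix, in the chart around `x`, of the endomorphism `g⁻¹ A_g` of the tangent space
at `x`. -/
def schoutenEndo (x : M) : Matrix (Fin n) (Fin n) ℝ :=
  (metricMatrix x (extChartAt (𝓡 n) x x))⁻¹ * schoutenMatrix x (extChartAt (𝓡 n) x x)

/-- The `σ_k`-curvature at `x`: the `k`-th elementary symmetric function of the eigenvalues of
`g⁻¹ A_g`, counted with multiplicity (they are real since `A_g` is symmetric). The value
for `k = 0` is `1`. -/
def sigmaCurv (n : ℕ) {M : Type*} [TopologicalSpace M]
    [ChartedSpace (EuclideanSpace ℝ (Fin n)) M]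
    [RiemannianBundle (fun x : M => TangentSpace (𝓡 n) x)] (k : ℕ) (x : M) : ℝ :=
  (schoutenEndo (n := n) x).charpoly.roots.esymm k

/-- The Riemannian volume on the domain of the chart around `p`, i.e. `√(det g_{ij}) dy` on the
target of the chart, carried to `M`. -/
def chartVolume (n : ℕ) {M : Type*} [TopologicalSpace M]
    [ChartedSpace (EuclideanSpace ℝ (Fin n)) M]
    [RiemannianBundle (fun x : M => TangentSpace (𝓡 n) x)] [MeasurableSpace M] (p : M) :
    Measure M :=
  (((volume : Measure (EuclideanSpace ℝ (Fin n))).restrict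
    (extChartAt (𝓡 n) p).target).withDensity
      fun y => ENNReal.ofReal (Real.sqrt (metricMatrix p y).det)).map (extChartAt (𝓡 n) p).symm

/-- The Riemannian volume measure `dv_g`. The measures `chartVolume n p` agree on overlaps of
charts, and `dv_g` is the measure glued from them: the least measure on `M` dominating all
of them. -/
def riemannianVolume (n : ℕ) (M : Type*) [TopologicalSpace M]
    [ChartedSpace (EuclideanSpace ℝ (Fin n)) M]
    [RiemannianBundle (fun x : M => TangentSpace (𝓡 n) x)] [MeasurableSpace M] : Measure M :=
  ⨆ p : M, chartVolume n p

end Coordinates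

section Soliton

variable {n : ℕ} {M : Type*} [TopologicalSpace M] [ChartedSpace (EuclideanSpace ℝ (Fin n)) M]

/-- A vector field on `M` is smooth if it is a `C^∞` section of the tangent bundle. -/
def IsSmoothVectorField [IsManifold (𝓡 n) ∞ M] (X : Π x : M, TangentSpace (𝓡 n) x) : Prop :=
  ContMDiff (𝓡 n) (𝓡 n).tangent ∞
    (fun x => (TotalSpace.mk' (EuclideanSpace ℝ (Fin n)) x (X x) : TangentBundle (𝓡 n) M))

variable [RiemannianBundle (fun x : M => TangentSpace (𝓡 n) x)]

/-- The Lie derivative of the metric, evaluated on vector fields: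
`(𝓛_X g)(Y, Z) = X (g(Y, Z)) - g([X, Y], Z) - g(Y, [X, Z])`. -/
def lieDerivMetric (X Y Z : Π x : M, TangentSpace (𝓡 n) x) (x : M) : ℝ :=
  mvfderiv (𝓡 n) (fun y => (inner ℝ (Y y) (Z y) : ℝ)) x (X x)
    - inner ℝ (VectorField.mlieBracket (𝓡 n) X Y x) (Z x)
    - inner ℝ (Y x) (VectorField.mlieBracket (𝓡 n) X Z x)

variable [IsManifold (𝓡 n) ∞ M]

/-- `𝓛_X g ≥ 0`: the symmetric 2-tensor `𝓛_X g` is positive semidefinite at each point. -/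
def LieDerivMetricNonneg (X : Π x : M, TangentSpace (𝓡 n) x) : Prop :=
  ∀ Y : Π x : M, TangentSpace (𝓡 n) x, IsSmoothVectorField Y → ∀ x, 0 ≤ lieDerivMetric X Y Y x

/-- `(M, g, X, lam)` is a quotient almost Yamabe soliton (for the pair `k`, `l`):
`X` and `lam` are smooth, `σ_k σ_l > 0`, and `½ 𝓛_X g = (log (σ_k / σ_l) - lam) g`. -/
structure IsQuotientAlmostYamabeSoliton (k l : ℕ) (X : Π x : M, TangentSpace (𝓡 n) x)
    (lam : M → ℝ) : Prop where
  smooth_field : IsSmoothVectorField X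
  smooth_lam : ContMDiff (𝓡 n) 𝓘(ℝ, ℝ) ∞ lam
  sigma_pos : ∀ x : M, 0 < sigmaCurv n k x * sigmaCurv n l x
  equation : ∀ Y Z : Π x : M, TangentSpace (𝓡 n) x,
    IsSmoothVectorField Y → IsSmoothVectorField Z → ∀ x,
      1 / 2 * lieDerivMetric X Y Z x =
        (Real.log (sigmaCurv n k x / sigmaCurv n l x) - lam x) * inner ℝ (Y x) (Z x)

/-- The soliton is trivial if its defining equation vanishes identically: `𝓛_X g = 0` and
`log (σ_k / σ_l) - lam = 0`. -/
def IsTrivialSoliton (k l : ℕ) (X : Π x : M, TangentSpace (𝓡 n) x) (lam : M → ℝ) : Prop :=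
  (∀ Y Z : Π x : M, TangentSpace (𝓡 n) x,
    IsSmoothVectorField Y → IsSmoothVectorField Z → ∀ x, lieDerivMetric X Y Z x = 0) ∧
  ∀ x : M, Real.log (sigmaCurv n k x / sigmaCurv n l x) - lam x = 0

end Soliton

end

/-! The soliton equation says that `X` is a conformal field with factor
`φ = log (σ_k / σ_l) - lam`, that is `½ 𝓛_X g = φ g`; nothing else about the curvatures is needed.
Tracing gives `div X = n φ`, and `𝓛_X g ≥ 0` gives `φ ≥ 0`. Integrate `div X` against the radial
cutoff `ψ_R`, which is `1` on the ball `B_R` around `x₀`, `0` outside `B_{2R}` and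
`1 / R`-Lipschitz. The divergence theorem yields

`n ∫_{B_R} φ ≤ ∫ ψ_R div X = -∫ ⟨∇ψ_R, X⟩ ≤ (1 / R) ∫_{B_{2R} \ B_R} |X| ≤ 2 ∫_{M \ B_R} |X| / d`,

and the right-hand side tends to zero as `R → ∞`. As `φ` is continuous and nonnegative and the
volume of a nonempty open set is positive, `φ = 0`, so that `𝓛_X g = 0` as well. The
argument rests on the following facts.

* In a chart, `√(det g) div X = ∑_c ∂_c (√(det g) X^c)`. The factor `n φ √(det g)` comes from
  Jacobi's formula and the coordinate expression of `𝓛_X g`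
  (`lieDerivMetric_coord`, `IsConformalField.divergence_coord`). The same formula
  shows that `φ` is continuous, as `X` and `g` are smooth; no regularity of `σ_k` is used.
* The measure `dv_g` is a supremum of chart measures; on the domain of a chart it is the chart
  measure (`riemannianVolume_eq_chartVolume`), by the change of variables formula and a countable
  gluing.
* Closed balls are compact (`properSpace_of_isRiemannianManifold`), so the cutoffs have compact
  support. Completeness enters only here.
* The divergence theorem is needed as an inequality, for a compactly supported Lipschitz function
  `ψ` (`IsConformalField.integral_mul_le`). A smooth partition of unity reduces it to charts, where
  Rademacher's theorem gives almost everywhere derivatives of `ψ`. Comparing the Riemannian distance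
  with lengths of coordinate segments (`abs_fderiv_le_of_dist`) bounds `dψ (X)` by `b |X|`,
  where `b` is any bound for the local Lipschitz constant of `ψ` with respect to the distance.
-/

open Set Filter Topology VectorField Manifold

/-! ### Smooth vector fields in charts -/

section Charts

variable {n : ℕ} {M : Type*} [TopologicalSpace M] [ChartedSpace (EuclideanSpace ℝ (Fin n)) M]
  [IsManifold (𝓡 n) ∞ M]

/-- The coordinate representation, in the chart around `p`, of the vector field `X`. -/
noncomputable def coordVec (p : M) (X : Π x : M, TangentSpace (𝓡 n) x)
    (y : EuclideanSpace ℝ (Fin n)) : EuclideanSpace ℝ (Fin n) :=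
  mpullback 𝓘(ℝ, EuclideanSpace ℝ (Fin n)) (𝓡 n) (extChartAt (𝓡 n) p).symm X y

theorem contMDiffAt_chart_symm {p : M} {y : EuclideanSpace ℝ (Fin n)}
    (hy : y ∈ (extChartAt (𝓡 n) p).target) :
    ContMDiffAt 𝓘(ℝ, EuclideanSpace ℝ (Fin n)) (𝓡 n) ∞ (extChartAt (𝓡 n) p).symm y :=
  (contMDiffOn_extChartAt_symm p).contMDiffAt ((isOpen_extChartAt_target p).mem_nhds hy)

theorem mdifferentiableAt_chart_symm {p : M} {y : EuclideanSpace ℝ (Fin n)}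
    (hy : y ∈ (extChartAt (𝓡 n) p).target) :
    MDifferentiableAt 𝓘(ℝ, EuclideanSpace ℝ (Fin n)) (𝓡 n) (extChartAt (𝓡 n) p).symm y :=
  (contMDiffAt_chart_symm hy).mdifferentiableAt (by simp)

theorem isInvertible_mfderiv_chart_symm {p : M} {y : EuclideanSpace ℝ (Fin n)}
    (hy : y ∈ (extChartAt (𝓡 n) p).target) :
    (mfderiv 𝓘(ℝ, EuclideanSpace ℝ (Fin n)) (𝓡 n) (extChartAt (𝓡 n) p).symm y).IsInvertible := by
  have : IsManifold (𝓡 n) 1 M := .of_le (n := ∞) (by simp)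
  have h := isInvertible_mfderivWithin_extChartAt_symm (I := 𝓡 n) hy
  rwa [ModelWithCorners.range_eq_univ, mfderivWithin_univ] at h

theorem mfderiv_chart_symm_coordVec {p : M} {y : EuclideanSpace ℝ (Fin n)}
    (hy : y ∈ (extChartAt (𝓡 n) p).target) (X : Π x : M, TangentSpace (𝓡 n) x) :
    mfderiv 𝓘(ℝ, EuclideanSpace ℝ (Fin n)) (𝓡 n) (extChartAt (𝓡 n) p).symm y (coordVec p X y)
      = X ((extChartAt (𝓡 n) p).symm y) :=
  (isInvertible_mfderiv_chart_symm hy).self_apply_inverse _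

theorem contDiffOn_coordVec (p : M) {X : Π x : M, TangentSpace (𝓡 n) x}
    (hX : IsSmoothVectorField X) :
    ContDiffOn ℝ ∞ (coordVec p X) (extChartAt (𝓡 n) p).target := by
  intro y hy
  apply ContDiffAt.contDiffWithinAt
  rw [← contDiffWithinAt_univ]
  refine contMDiffWithinAt_vectorSpace_iff_contDiffWithinAt.1 ?_
  rw [contMDiffWithinAt_univ]
  exact ContMDiffAt.mpullback_vectorField_preimage (hX _) (contMDiffAt_chart_symm hy)
    (isInvertible_mfderiv_chart_symm hy) (by simp)

/-- The vector field on the domain of the chart around `p` whose coordinates are constant, extended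
to a globally smooth vector field without changing it near a given point of this domain. -/
theorem exists_smooth_extension_const [T2Space M] {p : M} {y : EuclideanSpace ℝ (Fin n)}
    (hy : y ∈ (extChartAt (𝓡 n) p).target) (v : EuclideanSpace ℝ (Fin n)) :
    ∃ Y : Π x : M, TangentSpace (𝓡 n) x, IsSmoothVectorField Y ∧
      ∀ᶠ z in 𝓝 y, Y ((extChartAt (𝓡 n) p).symm z) =
        mfderiv 𝓘(ℝ, EuclideanSpace ℝ (Fin n)) (𝓡 n) (extChartAt (𝓡 n) p).symm z v := by
  have : IsManifold (𝓡 n) 1 M := .of_le (n := ∞) (by simp)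
  set q := (extChartAt (𝓡 n) p).symm y with hq
  have hqs : q ∈ (extChartAt (𝓡 n) p).source := (extChartAt (𝓡 n) p).map_target hy
  have hopen := isOpen_extChartAt_source (I := 𝓡 n) p
  obtain ⟨f, -, hfs⟩ := ((SmoothBumpFunction.nhds_basis_tsupport (I := 𝓡 n) q).mem_iff).1
    (hopen.mem_nhds hqs)
  let Y₀ : Π x : M, TangentSpace (𝓡 n) x :=
    mpullback (𝓡 n) 𝓘(ℝ, EuclideanSpace ℝ (Fin n)) (extChartAt (𝓡 n) p) (fun _ => v)
  have hY₀ : ContMDiffOn (𝓡 n) (𝓡 n).tangent ∞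
      (fun x => (TotalSpace.mk' (EuclideanSpace ℝ (Fin n)) x (Y₀ x) : TangentBundle (𝓡 n) M))
      (extChartAt (𝓡 n) p).source := by
    intro x hx
    apply ContMDiffAt.contMDiffWithinAt
    refine ContMDiffAt.mpullback_vectorField_preimage (n := ∞) ?_
      (contMDiffAt_extChartAt' (by simpa using hx)) (isInvertible_mfderiv_extChartAt hx) (by simp)
    rw [← contMDiffWithinAt_univ]
    exact contMDiffWithinAt_vectorSpace_iff_contDiffWithinAt.2 contDiffWithinAt_const
  refine ⟨fun x => f x • Y₀ x, ?_, ?_⟩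
  · exact ContMDiffOn.smul_section_of_tsupport f.contMDiff.contMDiffOn hopen hfs hY₀
  · have h1 : ∀ᶠ z in 𝓝 y, f ((extChartAt (𝓡 n) p).symm z) = 1 :=
      (continuousAt_extChartAt_symm'' hy).eventually f.eventuallyEq_one
    filter_upwards [h1, (isOpen_extChartAt_target p).mem_nhds hy] with z hz hzt
    rw [hz, one_smul]
    have hzs := (extChartAt (𝓡 n) p).map_target hzt
    refine ((isInvertible_mfderiv_extChartAt (I := 𝓡 n) hzs).inverse_apply_eq).2 ?_
    have h := mfderiv_extChartAt_comp_mfderivWithin_extChartAt_symm (I := 𝓡 n) hzt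
    rw [ModelWithCorners.range_eq_univ, mfderivWithin_univ] at h
    exact (DFunLike.congr_fun h v).symm

end Charts

/-! ### The metric and its Lie derivative in charts -/

theorem EuclideanSpace.eq_sum_single {n : ℕ} (w : EuclideanSpace ℝ (Fin n)) :
    w = ∑ i, w i • EuclideanSpace.single i (1 : ℝ) := by
  ext j
  simp [WithLp.ofLp_sum, Pi.single_apply]

section Metric

variable {n : ℕ} {M : Type*} [TopologicalSpace M] [ChartedSpace (EuclideanSpace ℝ (Fin n)) M]
  [RiemannianBundle (fun x : M => TangentSpace (𝓡 n) x)]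

/-- The metric in coordinates: `g(u, v) = ∑_{ij} u^i v^j g_{ij}`. -/
theorem inner_mfderiv_chart_symm (p : M) (y u v : EuclideanSpace ℝ (Fin n)) :
    inner ℝ (mfderiv 𝓘(ℝ, EuclideanSpace ℝ (Fin n)) (𝓡 n) (extChartAt (𝓡 n) p).symm y u)
      (mfderiv 𝓘(ℝ, EuclideanSpace ℝ (Fin n)) (𝓡 n) (extChartAt (𝓡 n) p).symm y v)
      = ∑ i, ∑ j, u i * v j * metricMatrix p y i j := by
  have key : ∀ w : EuclideanSpace ℝ (Fin n),
      mfderiv 𝓘(ℝ, EuclideanSpace ℝ (Fin n)) (𝓡 n) (extChartAt (𝓡 n) p).symm y w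
        = ∑ i, w i • coordField p i y := by
    intro w
    conv_lhs => rw [EuclideanSpace.eq_sum_single w]
    exact (map_sum _ _ _).trans (Finset.sum_congr rfl fun i _ => map_smul _ _ _)
  rw [key u, key v, sum_inner]
  refine Finset.sum_congr rfl fun i _ => ?_
  rw [inner_sum]
  refine Finset.sum_congr rfl fun j _ => ?_
  rw [real_inner_smul_left, real_inner_smul_right, metricMatrix, Matrix.of_apply, mul_assoc]

theorem metricMatrix_symm (p : M) (y : EuclideanSpace ℝ (Fin n)) (i j : Fin n) :
    metricMatrix p y i j = metricMatrix p y j i := by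
  rw [metricMatrix, Matrix.of_apply, Matrix.of_apply, real_inner_comm]

variable [IsManifold (𝓡 n) ∞ M]

theorem metricMatrix_posDef (p : M) {y : EuclideanSpace ℝ (Fin n)}
    (hy : y ∈ (extChartAt (𝓡 n) p).target) : (metricMatrix p y).PosDef := by
  refine Matrix.PosDef.of_dotProduct_mulVec_pos ?_ ?_
  · ext i j
    simp [metricMatrix_symm p y j i]
  · intro x hx
    have h := inner_mfderiv_chart_symm p y (WithLp.toLp 2 x) (WithLp.toLp 2 x)
    have hpos : 0 < inner ℝ
        (mfderiv 𝓘(ℝ, EuclideanSpace ℝ (Fin n)) (𝓡 n) (extChartAt (𝓡 n) p).symm y (WithLp.toLp 2 x))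
        (mfderiv 𝓘(ℝ, EuclideanSpace ℝ (Fin n)) (𝓡 n) (extChartAt (𝓡 n) p).symm y
          (WithLp.toLp 2 x)) := by
      refine real_inner_self_pos.2 fun h0 => hx ?_
      have := (isInvertible_mfderiv_chart_symm hy).injective (h0.trans (map_zero _).symm)
      exact congrArg WithLp.ofLp this
    rw [h] at hpos
    refine hpos.trans_eq ?_
    simp only [dotProduct, Matrix.mulVec, star_trivial, Finset.mul_sum]
    refine Finset.sum_congr rfl fun i _ => Finset.sum_congr rfl fun j _ => ?_
    ring

variable [IsContMDiffRiemannianBundle (𝓡 n) ∞ (EuclideanSpace ℝ (Fin n))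
      (fun x : M => TangentSpace (𝓡 n) x)]

theorem contDiffOn_metricMatrix [T2Space M] (p : M) (i j : Fin n) :
    ContDiffOn ℝ ∞ (fun y => metricMatrix p y i j) (extChartAt (𝓡 n) p).target := by
  intro y hy
  obtain ⟨Y, hY, hYe⟩ := exists_smooth_extension_const hy (EuclideanSpace.single i (1 : ℝ))
  obtain ⟨Z, hZ, hZe⟩ := exists_smooth_extension_const hy (EuclideanSpace.single j (1 : ℝ))
  have h : ContMDiffAt 𝓘(ℝ, EuclideanSpace ℝ (Fin n)) 𝓘(ℝ, ℝ) ∞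
      (fun z => (inner ℝ (Y ((extChartAt (𝓡 n) p).symm z)) (Z ((extChartAt (𝓡 n) p).symm z)) : ℝ))
      y := by
    have h0 : ContMDiffAt (𝓡 n) 𝓘(ℝ, ℝ) ∞ (fun x => (inner ℝ (Y x) (Z x) : ℝ))
        ((extChartAt (𝓡 n) p).symm y) := ContMDiffAt.inner_bundle (hY _) (hZ _)
    exact h0.comp y (contMDiffAt_chart_symm hy)
  have h2 : ContDiffAt ℝ ∞ (fun z => metricMatrix p z i j) y := by
    refine h.contDiffAt.congr_of_eventuallyEq ?_
    filter_upwards [hYe, hZe] with z h1 h2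
    rw [h1, h2]
    rfl
  exact h2.contDiffWithinAt

/-- The Lie derivative of the metric in coordinates:
`(𝓛_X g)_{ab} = ∑_c (X^c ∂_c g_{ab} + g_{cb} ∂_a X^c + g_{ac} ∂_b X^c)`. -/
theorem lieDerivMetric_coord [T2Space M] {X : Π x : M, TangentSpace (𝓡 n) x}
    (hX : IsSmoothVectorField X)
    {p : M} {y : EuclideanSpace ℝ (Fin n)} (hy : y ∈ (extChartAt (𝓡 n) p).target)
    {Y Z : Π x : M, TangentSpace (𝓡 n) x} (hY : IsSmoothVectorField Y)
    (hZ : IsSmoothVectorField Z) (a b : Fin n)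
    (hYe : ∀ᶠ z in 𝓝 y, Y ((extChartAt (𝓡 n) p).symm z) = coordField p a z)
    (hZe : ∀ᶠ z in 𝓝 y, Z ((extChartAt (𝓡 n) p).symm z) = coordField p b z) :
    lieDerivMetric X Y Z ((extChartAt (𝓡 n) p).symm y) =
      ∑ c, (coordVec p X y c * partialDeriv c (fun z => metricMatrix p z a b) y
        + metricMatrix p y c b * partialDeriv a (fun z => coordVec p X z c) y
        + metricMatrix p y a c * partialDeriv b (fun z => coordVec p X z c) y) := by
  have hmd : MDifferentiableAt 𝓘(ℝ, EuclideanSpace ℝ (Fin n)) (𝓡 n) (extChartAt (𝓡 n) p).symm y :=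
    mdifferentiableAt_chart_symm hy
  have hopen := isOpen_extChartAt_target (I := 𝓡 n) p
  have hVd : DifferentiableAt ℝ (coordVec p X) y :=
    ((contDiffOn_coordVec p hX).contDiffAt (hopen.mem_nhds hy)).differentiableAt (by simp)
  have h2 : (2 : WithTop ℕ∞) ≤ ((⊤ : ℕ∞) : WithTop ℕ∞) := ENat.LEInfty.out
  -- the Lie bracket of `X` with a coordinate field, computed in the chart
  have bracket : ∀ (W : Π x : M, TangentSpace (𝓡 n) x) (d : Fin n), IsSmoothVectorField W →
      (∀ᶠ z in 𝓝 y, W ((extChartAt (𝓡 n) p).symm z) = coordField p d z) →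
      mlieBracket (𝓡 n) X W ((extChartAt (𝓡 n) p).symm y) =
        mfderiv 𝓘(ℝ, EuclideanSpace ℝ (Fin n)) (𝓡 n) (extChartAt (𝓡 n) p).symm y
          (-fderiv ℝ (coordVec p X) y (EuclideanSpace.single d (1 : ℝ))) := by
    intro W d hW hWe
    have : IsManifold (𝓡 n) (minSmoothness ℝ 2) M := .of_le (n := ∞) (by simpa using h2)
    have h := mpullback_mlieBracket (V := X) (W := W) (n := ∞)
      ((hX _).mdifferentiableAt (by simp)) ((hW _).mdifferentiableAt (by simp))
      (contMDiffAt_chart_symm hy) (by simpa using h2)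
    have hWc : mpullback 𝓘(ℝ, EuclideanSpace ℝ (Fin n)) (𝓡 n) (extChartAt (𝓡 n) p).symm W
        =ᶠ[𝓝 y] fun _ => EuclideanSpace.single d (1 : ℝ) := by
      filter_upwards [hWe, hopen.mem_nhds hy] with z hz hzt
      exact ((isInvertible_mfderiv_chart_symm hzt).inverse_apply_eq).2 hz
    have hb := (EventuallyEq.refl (𝓝 y) (coordVec p X)).mlieBracket_vectorField_eq
      (I := 𝓘(ℝ, EuclideanSpace ℝ (Fin n))) hWc
    have hb' := congrFun (mlieBracketWithin_eq_lieBracketWithin (𝕜 := ℝ) (V := coordVec p X)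
      (W := fun _ : EuclideanSpace ℝ (Fin n) => EuclideanSpace.single d (1 : ℝ)) (s := univ)) y
    rw [lieBracketWithin_univ] at hb'
    have h' := ((isInvertible_mfderiv_chart_symm hy).inverse_apply_eq).1 (h.trans (hb.trans hb'))
    rw [h']
    congr 1
    change fderiv ℝ (fun _ : EuclideanSpace ℝ (Fin n) => EuclideanSpace.single d (1 : ℝ)) y
      (coordVec p X y) - fderiv ℝ (coordVec p X) y (EuclideanSpace.single d (1 : ℝ)) = _
    simp
  have hcomp : ∀ d c, partialDeriv d (fun z => coordVec p X z c) y
      = fderiv ℝ (coordVec p X) y (EuclideanSpace.single d (1 : ℝ)) c := by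
    intro d c
    have h := ((EuclideanSpace.proj c : EuclideanSpace ℝ (Fin n) →L[ℝ] ℝ).hasFDerivAt.comp y
      hVd.hasFDerivAt).fderiv
    rw [partialDeriv]
    exact DFunLike.congr_fun h _
  -- the derivative of `g(Y, Z)` along `X`
  have hder : mvfderiv (𝓡 n) (fun q => (inner ℝ (Y q) (Z q) : ℝ)) ((extChartAt (𝓡 n) p).symm y)
      (X ((extChartAt (𝓡 n) p).symm y)) =
      ∑ c, coordVec p X y c * partialDeriv c (fun z => metricMatrix p z a b) y := by
    have h0 : MDifferentiableAt (𝓡 n) 𝓘(ℝ, ℝ) (fun x => (inner ℝ (Y x) (Z x) : ℝ))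
        ((extChartAt (𝓡 n) p).symm y) :=
      (ContMDiffAt.inner_bundle (hY _) (hZ _)).mdifferentiableAt (n := ∞) (by simp)
    have hc := mfderiv_comp y h0 hmd
    have he : (fun x => (inner ℝ (Y x) (Z x) : ℝ)) ∘ (extChartAt (𝓡 n) p).symm
        =ᶠ[𝓝 y] fun z => metricMatrix p z a b := by
      filter_upwards [hYe, hZe] with z h1 h2
      simp only [Function.comp_apply]
      rw [h1, h2]
      rfl
    rw [← mfderiv_chart_symm_coordVec hy X]
    have h3 := DFunLike.congr_fun hc (coordVec p X y)
    rw [mfderiv_eq_fderiv, he.fderiv_eq] at h3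
    refine (show _ = fderiv ℝ (fun z => metricMatrix p z a b) y (coordVec p X y) from
      h3.symm).trans ?_
    conv_lhs => rw [EuclideanSpace.eq_sum_single (coordVec p X y)]
    rw [map_sum]
    simp only [map_smul, smul_eq_mul, partialDeriv]
  rw [lieDerivMetric, hder, bracket Y a hY hYe, bracket Z b hZ hZe, hYe.self_of_nhds,
    hZe.self_of_nhds, coordField, coordField, inner_mfderiv_chart_symm, inner_mfderiv_chart_symm]
  simp only [Finset.sum_add_distrib, hcomp, sub_eq_add_neg]
  congr 1
  · congr 1
    rw [← Finset.sum_neg_distrib]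
    refine Finset.sum_congr rfl fun c _ => ?_
    rw [Finset.sum_eq_single b]
    · simp; ring
    · intro j _ hj; simp [hj]
    · simp
  · rw [Finset.sum_eq_single a]
    · rw [← Finset.sum_neg_distrib]
      refine Finset.sum_congr rfl fun c _ => ?_
      simp; ring
    · intro j _ hj; simp [hj]
    · simp

end Metric

/-! ### Divergence of a conformal field in coordinates -/

section Divergence

variable {n : ℕ}

theorem det_updateRow_eq_sum_adjugate (B : Matrix (Fin n) (Fin n) ℝ) (i : Fin n) (w : Fin n → ℝ) :
    (B.updateRow i w).det = ∑ j, B.adjugate j i * w j := by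
  rw [← Matrix.det_transpose, ← Matrix.updateCol_transpose, ← Matrix.cramer_apply,
    Matrix.cramer_eq_adjugate_mulVec, ← Matrix.adjugate_transpose]
  rfl

/-- Jacobi's formula for the derivative of a determinant. -/
theorem fderiv_det_apply {E : Type*} [NormedAddCommGroup E] [NormedSpace ℝ E]
    {A : E → Matrix (Fin n) (Fin n) ℝ} {y : E}
    (hA : ∀ i j, DifferentiableAt ℝ (fun z => A z i j) y) (v : E) :
    DifferentiableAt ℝ (fun z => (A z).det) y ∧
    fderiv ℝ (fun z => (A z).det) y v =
      ∑ i, ∑ j, (A y).adjugate j i * fderiv ℝ (fun z => A z i j) y v := by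
  let D : ContinuousMultilinearMap ℝ (fun _ : Fin n => Fin n → ℝ) ℝ :=
    ⟨(Matrix.detRowAlternating (n := Fin n) (R := ℝ)).toMultilinearMap,
      (continuous_id (X := Matrix (Fin n) (Fin n) ℝ)).matrix_det⟩
  have hA' : HasFDerivAt (fun z => (fun i j => A z i j : Fin n → Fin n → ℝ))
      (ContinuousLinearMap.pi fun i => ContinuousLinearMap.pi fun j =>
        fderiv ℝ (fun z => A z i j) y) y :=
    hasFDerivAt_pi.2 fun i => hasFDerivAt_pi.2 fun j => (hA i j).hasFDerivAt
  have h := (D.hasFDerivAt (fun i j => A y i j)).comp y hA'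
  have hD : (fun z => (A z).det) = D ∘ (fun z => (fun i j => A z i j : Fin n → Fin n → ℝ)) := rfl
  rw [hD]
  refine ⟨h.differentiableAt, ?_⟩
  rw [h.fderiv, ContinuousLinearMap.comp_apply, ContinuousMultilinearMap.linearDeriv_apply]
  refine Finset.sum_congr rfl fun i _ => ?_
  exact det_updateRow_eq_sum_adjugate (A y) i fun j => fderiv ℝ (fun z => A z i j) y v

/-- If `½ 𝓛_V g = φ g` in coordinates, then tracing with `g⁻¹` gives
`∑_c ∂_c (√(det g) V^c) = n φ √(det g)`. -/
theorem sum_partialDeriv_sqrt_det_mul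
    {g : EuclideanSpace ℝ (Fin n) → Matrix (Fin n) (Fin n) ℝ}
    {V : EuclideanSpace ℝ (Fin n) → EuclideanSpace ℝ (Fin n)} {y : EuclideanSpace ℝ (Fin n)}
    {φ : ℝ} (hg : ∀ i j, DifferentiableAt ℝ (fun z => g z i j) y) (hV : DifferentiableAt ℝ V y)
    (hpos : (g y).PosDef)
    (heq : ∀ a b, ∑ c, (V y c * partialDeriv c (fun z => g z a b) y
        + g y c b * partialDeriv a (fun z => V z c) y
        + g y a c * partialDeriv b (fun z => V z c) y) = 2 * φ * g y a b) :
    ∑ c, partialDeriv c (fun z => Real.sqrt (g z).det * V z c) y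
      = n * φ * Real.sqrt (g y).det := by
  have hdet : 0 < (g y).det := hpos.det_pos
  have hunit : IsUnit (g y).det := hdet.ne'.isUnit
  set G := Real.sqrt (g y).det with hG
  have hGpos : 0 < G := Real.sqrt_pos.2 hdet
  have hGG : G * G = (g y).det := Real.mul_self_sqrt hdet.le
  set h := (g y)⁻¹ with hh
  have hadj : ∀ i j, (g y).adjugate i j = G * G * h i j := by
    intro i j
    rw [hh, Matrix.inv_def, hGG, Matrix.smul_apply, smul_eq_mul, Ring.inverse_eq_inv',
      mul_inv_cancel_left₀ hdet.ne']
  have hVc : ∀ c, DifferentiableAt ℝ (fun z => V z c) y := fun c =>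
    (EuclideanSpace.proj c : EuclideanSpace ℝ (Fin n) →L[ℝ] ℝ).differentiableAt.comp y hV
  have hGd : DifferentiableAt ℝ (fun z => Real.sqrt (g z).det) y :=
    ((fderiv_det_apply hg 0).1).sqrt hdet.ne'
  have hGder : ∀ c, partialDeriv c (fun z => Real.sqrt (g z).det) y
      = G / 2 * ∑ a, ∑ b, h b a * partialDeriv c (fun z => g z a b) y := by
    intro c
    have hd := fderiv_det_apply hg (EuclideanSpace.single c (1 : ℝ))
    rw [partialDeriv, (hd.1.hasFDerivAt.sqrt hdet.ne').fderiv, smul_apply, hd.2,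
      ← hG, smul_eq_mul, Finset.mul_sum, Finset.mul_sum]
    refine Finset.sum_congr rfl fun a _ => ?_
    rw [Finset.mul_sum, Finset.mul_sum]
    refine Finset.sum_congr rfl fun b _ => ?_
    rw [hadj, partialDeriv]
    field_simp
  have hprod : ∀ c, partialDeriv c (fun z => Real.sqrt (g z).det * V z c) y
      = G * partialDeriv c (fun z => V z c) y
        + V y c * partialDeriv c (fun z => Real.sqrt (g z).det) y := by
    intro c
    rw [partialDeriv, fderiv_fun_mul hGd (hVc c)]
    rfl
  have hgh : ∀ i k, ∑ j, g y i j * h j k = if i = k then 1 else 0 := by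
    intro i k
    have := congrFun (congrFun (Matrix.mul_nonsing_inv (g y) hunit) i) k
    rwa [Matrix.mul_apply, Matrix.one_apply] at this
  have hhg : ∀ i k, ∑ j, h i j * g y j k = if i = k then 1 else 0 := by
    intro i k
    have := congrFun (congrFun (Matrix.nonsing_inv_mul (g y) hunit) i) k
    rwa [Matrix.mul_apply, Matrix.one_apply] at this
  have htr : ∑ a, ∑ b, h b a * (2 * φ * g y a b) = 2 * φ * n := by
    rw [Finset.sum_comm]
    calc _ = ∑ b : Fin n, 2 * φ * ∑ a, h b a * g y a b := by
            refine Finset.sum_congr rfl fun b _ => ?_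
            rw [Finset.mul_sum]
            exact Finset.sum_congr rfl fun a _ => by ring
      _ = 2 * φ * n := by simp only [hhg]; simp [mul_comm]
  have h2 : ∑ a, ∑ b, h b a * ∑ c, g y c b * partialDeriv a (fun z => V z c) y
      = ∑ c, partialDeriv c (fun z => V z c) y := by
    calc _ = ∑ a, ∑ c, (∑ b, g y c b * h b a) * partialDeriv a (fun z => V z c) y := by
            refine Finset.sum_congr rfl fun a _ => ?_
            simp only [Finset.mul_sum, Finset.sum_mul]
            rw [Finset.sum_comm]
            exact Finset.sum_congr rfl fun c _ => Finset.sum_congr rfl fun b _ => by ring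
      _ = _ := by simp [hgh]
  have h3 : ∑ a, ∑ b, h b a * ∑ c, g y a c * partialDeriv b (fun z => V z c) y
      = ∑ c, partialDeriv c (fun z => V z c) y := by
    rw [Finset.sum_comm]
    calc _ = ∑ b, ∑ c, (∑ a, h b a * g y a c) * partialDeriv b (fun z => V z c) y := by
            refine Finset.sum_congr rfl fun b _ => ?_
            simp only [Finset.mul_sum, Finset.sum_mul]
            rw [Finset.sum_comm]
            exact Finset.sum_congr rfl fun c _ => Finset.sum_congr rfl fun b _ => by ring
      _ = _ := by simp [hhg]
  have h1 : ∑ a, ∑ b, h b a * ∑ c, V y c * partialDeriv c (fun z => g z a b) y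
      = ∑ c, V y c * ∑ a, ∑ b, h b a * partialDeriv c (fun z => g z a b) y := by
    simp only [Finset.mul_sum]
    rw [Finset.sum_comm' (t' := Finset.univ) (s' := fun _ => Finset.univ) (by simp)]
    rw [Finset.sum_congr rfl fun b _ => Finset.sum_comm]
    rw [Finset.sum_comm]
    refine Finset.sum_congr rfl fun c _ => ?_
    rw [Finset.sum_comm]
    exact Finset.sum_congr rfl fun a _ => Finset.sum_congr rfl fun b _ => by ring
  have hsum : ∑ c, V y c * (∑ a, ∑ b, h b a * partialDeriv c (fun z => g z a b) y)
      + 2 * ∑ c, partialDeriv c (fun z => V z c) y = 2 * φ * n := by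
    rw [← htr, two_mul]
    conv_lhs => rw [← h1]; arg 2; arg 1; rw [← h2]
    rw [← h3, ← Finset.sum_add_distrib, ← Finset.sum_add_distrib]
    refine Finset.sum_congr rfl fun a _ => ?_
    rw [← Finset.sum_add_distrib, ← Finset.sum_add_distrib]
    refine Finset.sum_congr rfl fun b _ => ?_
    rw [← heq a b]
    simp only [Finset.sum_add_distrib]
    ring
  simp only [hprod, hGder, Finset.sum_add_distrib]
  rw [← Finset.mul_sum]
  have : ∑ c, V y c * (G / 2 * ∑ a, ∑ b, h b a * partialDeriv c (fun z => g z a b) y)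
      = G / 2 * ∑ c, V y c * (∑ a, ∑ b, h b a * partialDeriv c (fun z => g z a b) y) := by
    rw [Finset.mul_sum]
    exact Finset.sum_congr rfl fun c _ => by ring
  rw [this]
  linear_combination G / 2 * hsum

end Divergence

/-! ### The Riemannian volume -/

section Volume

variable {n : ℕ} {M : Type*} [TopologicalSpace M] [ChartedSpace (EuclideanSpace ℝ (Fin n)) M]

theorem measurableSet_target_inter_preimage [MeasurableSpace M] [BorelSpace M] (p : M)
    {A : Set M} (hA : MeasurableSet A) :
    MeasurableSet ((extChartAt (𝓡 n) p).target ∩ (extChartAt (𝓡 n) p).symm ⁻¹' A) := by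
  have ht := (isOpen_extChartAt_target (I := 𝓡 n) p).measurableSet
  have h := (continuousOn_extChartAt_symm (I := 𝓡 n) p).domRestrict.measurable hA
  have h2 := ht.subtype_image h
  convert h2 using 1
  ext y
  simp [and_comm]

variable [RiemannianBundle (fun x : M => TangentSpace (𝓡 n) x)]

theorem aemeasurable_chart_symm [MeasurableSpace M] [BorelSpace M] (p : M) :
    AEMeasurable (extChartAt (𝓡 n) p).symm
    (((volume : Measure (EuclideanSpace ℝ (Fin n))).restrict
      (extChartAt (𝓡 n) p).target).withDensity
      fun y => ENNReal.ofReal (Real.sqrt (metricMatrix p y).det)) :=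
  ((continuousOn_extChartAt_symm p).aemeasurable
    (isOpen_extChartAt_target p).measurableSet).mono_ac (withDensity_absolutelyContinuous _ _)

variable [IsManifold (𝓡 n) ∞ M]

/-- On the overlap of two charts the densities `√(det g)` differ by the Jacobian determinant of
the coordinate change. -/
theorem exists_transition_jacobian (p q : M) {y : EuclideanSpace ℝ (Fin n)}
    (hy : y ∈ (extChartAt (𝓡 n) p).target)
    (hyq : (extChartAt (𝓡 n) p).symm y ∈ (extChartAt (𝓡 n) q).source) :
    HasFDerivAt (extChartAt (𝓡 n) q ∘ (extChartAt (𝓡 n) p).symm)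
      (fderiv ℝ (extChartAt (𝓡 n) q ∘ (extChartAt (𝓡 n) p).symm) y) y ∧
    Real.sqrt (metricMatrix p y).det =
      |(fderiv ℝ (extChartAt (𝓡 n) q ∘ (extChartAt (𝓡 n) p).symm) y).det| *
      Real.sqrt (metricMatrix q (extChartAt (𝓡 n) q ((extChartAt (𝓡 n) p).symm y))).det := by
  have hmp := mdifferentiableAt_chart_symm (n := n) hy
  have hcq : ContMDiffAt (𝓡 n) 𝓘(ℝ, EuclideanSpace ℝ (Fin n)) ∞ (extChartAt (𝓡 n) q)
      ((extChartAt (𝓡 n) p).symm y) := contMDiffAt_extChartAt' (by simpa using hyq)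
  have hτ : MDifferentiableAt 𝓘(ℝ, EuclideanSpace ℝ (Fin n)) 𝓘(ℝ, EuclideanSpace ℝ (Fin n))
      (extChartAt (𝓡 n) q ∘ (extChartAt (𝓡 n) p).symm) y :=
    (hcq.mdifferentiableAt (by simp)).comp y hmp
  set τ := extChartAt (𝓡 n) q ∘ (extChartAt (𝓡 n) p).symm with hτdef
  refine ⟨hτ.differentiableAt.hasFDerivAt, ?_⟩
  set J := fderiv ℝ τ y with hJ
  have hτy : τ y ∈ (extChartAt (𝓡 n) q).target := (extChartAt (𝓡 n) q).map_source hyq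
  have hfac : (extChartAt (𝓡 n) q).symm ∘ τ =ᶠ[𝓝 y] (extChartAt (𝓡 n) p).symm := by
    have h1 : ∀ᶠ z in 𝓝 y, (extChartAt (𝓡 n) p).symm z ∈ (extChartAt (𝓡 n) q).source :=
      (continuousAt_extChartAt_symm'' hy).eventually
        ((isOpen_extChartAt_source (I := 𝓡 n) q).mem_nhds hyq)
    filter_upwards [h1] with z hz
    exact (extChartAt (𝓡 n) q).left_inv hz
  have hcomp := mfderiv_comp y (mdifferentiableAt_chart_symm (n := n) hτy) hτ
  rw [hfac.mfderiv_eq, mfderiv_eq_fderiv] at hcomp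
  have hcoord : ∀ i j, metricMatrix p y i j = ∑ k, ∑ l,
      J (EuclideanSpace.single i (1 : ℝ)) k * J (EuclideanSpace.single j (1 : ℝ)) l *
        metricMatrix q (τ y) k l := by
    intro i j
    rw [← inner_mfderiv_chart_symm q (τ y)]
    have hv := fun v => DFunLike.congr_fun hcomp v
    have hx : (extChartAt (𝓡 n) q).symm (τ y) = (extChartAt (𝓡 n) p).symm y :=
      (extChartAt (𝓡 n) q).left_inv hyq
    have hgen : ∀ (x x' : M) (_ : x = x') (u v : EuclideanSpace ℝ (Fin n)),
        (inner ℝ (show TangentSpace (𝓡 n) x from u) (show TangentSpace (𝓡 n) x from v) : ℝ)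
        = inner ℝ (show TangentSpace (𝓡 n) x' from u) (show TangentSpace (𝓡 n) x' from v) := by
      rintro x _ rfl u v; rfl
    rw [metricMatrix, Matrix.of_apply, coordField, coordField]
    refine (hgen _ _ hx.symm _ _).trans ?_
    exact congrArg₂ (fun u v : EuclideanSpace ℝ (Fin n) =>
      (inner ℝ (show TangentSpace (𝓡 n) ((extChartAt (𝓡 n) q).symm (τ y)) from u)
        (show TangentSpace (𝓡 n) ((extChartAt (𝓡 n) q).symm (τ y)) from v) : ℝ)) (hv _) (hv _)
  let Jm : Matrix (Fin n) (Fin n) ℝ := Matrix.of fun k i => J (EuclideanSpace.single i (1 : ℝ)) k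
  have hmat : metricMatrix p y = Jm.transpose * metricMatrix q (τ y) * Jm := by
    ext i j
    rw [hcoord, Matrix.mul_apply, Finset.sum_comm]
    refine Finset.sum_congr rfl fun l _ => ?_
    rw [Matrix.mul_apply, Finset.sum_mul]
    refine Finset.sum_congr rfl fun k _ => ?_
    simp only [Jm, Matrix.transpose_apply, Matrix.of_apply]
    ring
  have hJdet : J.det = Jm.det := by
    rw [ContinuousLinearMap.det, ← LinearMap.det_toMatrix
      (EuclideanSpace.basisFun (Fin n) ℝ).toBasis]
    congr 1
  have hqpos : 0 < (metricMatrix q (τ y)).det := (metricMatrix_posDef q hτy).det_pos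
  rw [hmat, Matrix.det_mul, Matrix.det_mul, Matrix.det_transpose, hJdet]
  rw [show Jm.det * (metricMatrix q (τ y)).det * Jm.det
    = Jm.det ^ 2 * (metricMatrix q (τ y)).det by ring, Real.sqrt_mul (sq_nonneg _),
    Real.sqrt_sq_eq_abs]
  rfl

variable [IsContMDiffRiemannianBundle (𝓡 n) ∞ (EuclideanSpace ℝ (Fin n))
      (fun x : M => TangentSpace (𝓡 n) x)]

theorem contDiffOn_sqrt_det_metricMatrix [T2Space M] (p : M) :
    ContDiffOn ℝ ∞ (fun y => Real.sqrt (metricMatrix p y).det) (extChartAt (𝓡 n) p).target := by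
  have h : ContDiffOn ℝ ∞ (fun y => (metricMatrix p y).det) (extChartAt (𝓡 n) p).target := by
    simp only [Matrix.det_apply]
    refine ContDiffOn.sum fun σ _ => ?_
    refine ContDiffOn.const_smul _ (contDiffOn_prod fun i _ => contDiffOn_metricMatrix p _ _)
  exact h.sqrt fun y hy => (metricMatrix_posDef p hy).det_pos.ne'

theorem aemeasurable_sqrt_det [T2Space M] (p : M) :
    AEMeasurable (fun y => ENNReal.ofReal (Real.sqrt (metricMatrix p y).det))
      ((volume : Measure (EuclideanSpace ℝ (Fin n))).restrict (extChartAt (𝓡 n) p).target) :=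
  ((contDiffOn_sqrt_det_metricMatrix p).continuousOn.aemeasurable
    (isOpen_extChartAt_target p).measurableSet).ennreal_ofReal

variable [MeasurableSpace M] [BorelSpace M]

theorem lintegral_chartVolume [T2Space M] (p : M) {f : M → ℝ≥0∞} (hf : Measurable f) :
    ∫⁻ x, f x ∂(chartVolume n p) = ∫⁻ y in (extChartAt (𝓡 n) p).target,
      ENNReal.ofReal (Real.sqrt (metricMatrix p y).det) * f ((extChartAt (𝓡 n) p).symm y) := by
  rw [chartVolume, lintegral_map' hf.aemeasurable (aemeasurable_chart_symm p),
    lintegral_withDensity_eq_lintegral_mul₀ (aemeasurable_sqrt_det p)]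
  · rfl
  · exact hf.comp_aemeasurable ((continuousOn_extChartAt_symm p).aemeasurable
      (isOpen_extChartAt_target p).measurableSet)

theorem chartVolume_apply [T2Space M] (p : M) {A : Set M} (hA : MeasurableSet A) :
    chartVolume n p A = ∫⁻ y in (extChartAt (𝓡 n) p).target ∩ (extChartAt (𝓡 n) p).symm ⁻¹' A,
      ENNReal.ofReal (Real.sqrt (metricMatrix p y).det) := by
  rw [← lintegral_indicator_one hA, lintegral_chartVolume p (measurable_one.indicator hA),
    ← lintegral_indicator (isOpen_extChartAt_target p).measurableSet,
    ← lintegral_indicator (measurableSet_target_inter_preimage p hA)]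
  refine lintegral_congr fun y => ?_
  by_cases h1 : y ∈ (extChartAt (𝓡 n) p).target <;>
    by_cases h2 : (extChartAt (𝓡 n) p).symm y ∈ A <;> simp [h1, h2, -extChartAt, indicator]

theorem chartVolume_inter_source [T2Space M] (p : M) {A : Set M} (hA : MeasurableSet A) :
    chartVolume n p (A ∩ (extChartAt (𝓡 n) p).source) = chartVolume n p A := by
  rw [chartVolume_apply p hA,
    chartVolume_apply p (hA.inter (isOpen_extChartAt_source (I := 𝓡 n) p).measurableSet)]
  congr 2
  ext y
  simp only [mem_inter_iff, mem_preimage]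
  exact ⟨fun h => ⟨h.1, h.2.1⟩, fun h => ⟨h.1, h.2, (extChartAt (𝓡 n) p).map_target h.1⟩⟩

/-- The volume measures of two charts agree on the overlap of their domains. -/
theorem chartVolume_eq_of_subset [T2Space M] (p q : M) {A : Set M} (hA : MeasurableSet A)
    (hp : A ⊆ (extChartAt (𝓡 n) p).source) (hq : A ⊆ (extChartAt (𝓡 n) q).source) :
    chartVolume n p A = chartVolume n q A := by
  rw [chartVolume_apply p hA, chartVolume_apply q hA]
  set Sp := (extChartAt (𝓡 n) p).target ∩ (extChartAt (𝓡 n) p).symm ⁻¹' A with hSp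
  have himg : (extChartAt (𝓡 n) q).target ∩ (extChartAt (𝓡 n) q).symm ⁻¹' A
      = (extChartAt (𝓡 n) q ∘ (extChartAt (𝓡 n) p).symm) '' Sp := by
    ext z
    constructor
    · rintro ⟨hz, hzA⟩
      refine ⟨extChartAt (𝓡 n) p ((extChartAt (𝓡 n) q).symm z),
        ⟨(extChartAt (𝓡 n) p).map_source (hp hzA), ?_⟩, ?_⟩
      · rw [mem_preimage, (extChartAt (𝓡 n) p).left_inv (hp hzA)]
        exact hzA
      · rw [Function.comp_apply, (extChartAt (𝓡 n) p).left_inv (hp hzA),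
          (extChartAt (𝓡 n) q).right_inv hz]
    · rintro ⟨y, ⟨_, hyA⟩, rfl⟩
      refine ⟨(extChartAt (𝓡 n) q).map_source (hq hyA), ?_⟩
      rw [mem_preimage, Function.comp_apply, (extChartAt (𝓡 n) q).left_inv (hq hyA)]
      exact hyA
  have hinj : InjOn (extChartAt (𝓡 n) q ∘ (extChartAt (𝓡 n) p).symm) Sp := by
    intro y hy z hz h
    have h1 := (extChartAt (𝓡 n) q).injOn (hq hy.2) (hq hz.2) h
    rw [← (extChartAt (𝓡 n) p).right_inv hy.1, h1, (extChartAt (𝓡 n) p).right_inv hz.1]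
  rw [himg, lintegral_image_eq_lintegral_abs_det_fderiv_mul volume
    (measurableSet_target_inter_preimage p hA)
    (fun y hy => (exists_transition_jacobian p q hy.1 (hq hy.2)).1.hasFDerivWithinAt) hinj]
  refine setLIntegral_congr_fun (measurableSet_target_inter_preimage p hA) fun y hy => ?_
  rw [(exists_transition_jacobian p q hy.1 (hq hy.2)).2, ENNReal.ofReal_mul (abs_nonneg _)]
  rfl

variable [T2Space M] [SecondCountableTopology M]

/-- On the domain of a chart, the Riemannian volume is the volume measure of the chart: a measure
glued from the charts along a countable measurable partition dominates every chart volume and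
restricts to it on its domain. -/
theorem riemannianVolume_eq_chartVolume (p : M) {A : Set M} (hA : MeasurableSet A)
    (hp : A ⊆ (extChartAt (𝓡 n) p).source) : riemannianVolume n M A = chartVolume n p A := by
  refine le_antisymm ?_ ((le_iSup (fun q : M => chartVolume n q) p) A)
  obtain ⟨s, hs, hsu⟩ := TopologicalSpace.countable_cover_nhds
    (fun q : M => extChartAt_source_mem_nhds (I := 𝓡 n) q)
  have hne : s.Nonempty := by
    by_contra h
    rw [not_nonempty_iff_eq_empty] at h
    have : p ∈ ⋃ x ∈ s, (extChartAt (𝓡 n) x).source := hsu ▸ mem_univ p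
    simp [h] at this
  obtain ⟨c, hc⟩ := hs.exists_eq_range hne
  let U : ℕ → Set M := fun i => (extChartAt (𝓡 n) (c i)).source
  have hU : ⋃ i, U i = univ := by
    rw [← hsu, hc, biUnion_range]
  have hUm : ∀ i, MeasurableSet (U i) := fun i =>
    (isOpen_extChartAt_source (I := 𝓡 n) (c i)).measurableSet
  have hBm : ∀ i, MeasurableSet (disjointed U i) := fun i => MeasurableSet.disjointed hUm i
  let ν : Measure M := Measure.sum fun i => (chartVolume n (c i)).restrict (disjointed U i)
  have hν : ∀ (q : M) (B : Set M), MeasurableSet B → B ⊆ (extChartAt (𝓡 n) q).source →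
      ν B = chartVolume n q B := by
    intro q B hB hBq
    have h1 : B = ⋃ i, B ∩ disjointed U i := by
      rw [← inter_iUnion, iUnion_disjointed, hU, inter_univ]
    conv_rhs => rw [h1]
    rw [measure_iUnion (fun i j hij => ((disjoint_disjointed U) hij).mono inter_subset_right
      inter_subset_right) fun i => hB.inter (hBm i), Measure.sum_apply _ hB]
    refine tsum_congr fun i => ?_
    rw [Measure.restrict_apply hB]
    exact chartVolume_eq_of_subset _ _ (hB.inter (hBm i))
      (inter_subset_right.trans (disjointed_subset U i)) (inter_subset_left.trans hBq)
  have hle : riemannianVolume n M ≤ ν := by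
    refine iSup_le fun q => Measure.le_iff.2 fun B hB => ?_
    rw [← chartVolume_inter_source q hB, ← hν q _ (hB.inter
      (isOpen_extChartAt_source (I := 𝓡 n) q).measurableSet) inter_subset_right]
    exact measure_mono inter_subset_left
  exact (hle A).trans_eq (hν p A hA hp)

theorem restrict_riemannianVolume (p : M) :
    (riemannianVolume n M).restrict (extChartAt (𝓡 n) p).source = chartVolume n p := by
  ext A hA
  rw [Measure.restrict_apply hA, riemannianVolume_eq_chartVolume p
    (hA.inter (isOpen_extChartAt_source (I := 𝓡 n) p).measurableSet) inter_subset_right,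
    chartVolume_inter_source p hA]

theorem lintegral_riemannianVolume_of_support (p : M) {f : M → ℝ≥0∞} (hf : Measurable f)
    (hsupp : ∀ x, x ∉ (extChartAt (𝓡 n) p).source → f x = 0) :
    ∫⁻ x, f x ∂(riemannianVolume n M) = ∫⁻ y in (extChartAt (𝓡 n) p).target,
      ENNReal.ofReal (Real.sqrt (metricMatrix p y).det) * f ((extChartAt (𝓡 n) p).symm y) := by
  rw [← lintegral_chartVolume p hf, ← restrict_riemannianVolume p,
    setLIntegral_eq_of_support_subset]
  intro x hx
  by_contra h
  exact hx (hsupp x h)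

/-- An integral of a function supported in the domain of a chart, in coordinates: the density is
`√(det g)`. -/
theorem integral_riemannianVolume_of_support (p : M) {f : M → ℝ} (hf : Continuous f)
    (hsupp : ∀ x, x ∉ (extChartAt (𝓡 n) p).source → f x = 0) :
    ∫ x, f x ∂(riemannianVolume n M) = ∫ y in (extChartAt (𝓡 n) p).target,
      Real.sqrt (metricMatrix p y).det * f ((extChartAt (𝓡 n) p).symm y) := by
  rw [← setIntegral_eq_integral_of_forall_compl_eq_zero hsupp, restrict_riemannianVolume p,
    chartVolume, integral_map (aemeasurable_chart_symm p)
    (hf.measurable.aestronglyMeasurable),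
    integral_withDensity_eq_integral_toReal_smul₀ (aemeasurable_sqrt_det p) (by simp)]
  refine integral_congr_ae (Eventually.of_forall fun y => ?_)
  simp [ENNReal.toReal_ofReal (Real.sqrt_nonneg _), -extChartAt]

instance isLocallyFiniteMeasure_riemannianVolume :
    IsLocallyFiniteMeasure (riemannianVolume n M) := by
  refine ⟨fun p => ?_⟩
  have hpt : extChartAt (𝓡 n) p p ∈ (extChartAt (𝓡 n) p).target := mem_extChartAt_target p
  obtain ⟨ε, hε, hball⟩ := Metric.nhds_basis_closedBall.mem_iff.1
    ((isOpen_extChartAt_target (I := 𝓡 n) p).mem_nhds hpt)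
  let A : Set M := (extChartAt (𝓡 n) p).source ∩
    extChartAt (𝓡 n) p ⁻¹' Metric.ball (extChartAt (𝓡 n) p p) ε
  have hAo : IsOpen A := (continuousOn_extChartAt p).isOpen_inter_preimage
    (isOpen_extChartAt_source p) Metric.isOpen_ball
  refine ⟨A, hAo.mem_nhds ⟨mem_extChartAt_source p, Metric.mem_ball_self hε⟩, ?_⟩
  rw [riemannianVolume_eq_chartVolume p hAo.measurableSet inter_subset_left,
    chartVolume_apply p hAo.measurableSet]
  have hsub : (extChartAt (𝓡 n) p).target ∩ (extChartAt (𝓡 n) p).symm ⁻¹' A ⊆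
      Metric.closedBall (extChartAt (𝓡 n) p p) ε := by
    rintro y ⟨hy, -, hyA⟩
    rw [mem_preimage, (extChartAt (𝓡 n) p).right_inv hy] at hyA
    exact Metric.ball_subset_closedBall hyA
  refine (lintegral_mono_set hsub).trans_lt ?_
  have hc : ContinuousOn (fun y => Real.sqrt (metricMatrix p y).det)
      (Metric.closedBall (extChartAt (𝓡 n) p p) ε) :=
    (contDiffOn_sqrt_det_metricMatrix p).continuousOn.mono hball
  have := (hc.integrableOn_compact (isCompact_closedBall _ _) (μ := volume)).2
  refine lt_of_le_of_lt (lintegral_mono fun y => ?_) this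
  exact Real.ofReal_le_enorm _

theorem riemannianVolume_pos_of_isOpen {A : Set M} (hA : IsOpen A) (hne : A.Nonempty) :
    0 < riemannianVolume n M A := by
  obtain ⟨p, hp⟩ := hne
  let B := A ∩ (extChartAt (𝓡 n) p).source
  have hBo : IsOpen B := hA.inter (isOpen_extChartAt_source p)
  refine lt_of_lt_of_le ?_ (measure_mono (inter_subset_left : B ⊆ A))
  rw [riemannianVolume_eq_chartVolume p hBo.measurableSet inter_subset_right,
    chartVolume_apply p hBo.measurableSet]
  have hS : IsOpen ((extChartAt (𝓡 n) p).target ∩ (extChartAt (𝓡 n) p).symm ⁻¹' B) :=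
    (continuousOn_extChartAt_symm p).isOpen_inter_preimage (isOpen_extChartAt_target p) hBo
  have hSne : ((extChartAt (𝓡 n) p).target ∩ (extChartAt (𝓡 n) p).symm ⁻¹' B).Nonempty := by
    refine ⟨extChartAt (𝓡 n) p p, mem_extChartAt_target p, ?_⟩
    rw [mem_preimage, extChartAt_to_inv]
    exact ⟨hp, mem_extChartAt_source p⟩
  rw [pos_iff_ne_zero]
  intro h0
  rw [lintegral_eq_zero_iff' ((aemeasurable_sqrt_det p).mono_measure
    (Measure.restrict_mono inter_subset_left le_rfl))] at h0
  have h1 : ∀ᵐ y ∂(volume.restrict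
      ((extChartAt (𝓡 n) p).target ∩ (extChartAt (𝓡 n) p).symm ⁻¹' B)), False := by
    filter_upwards [h0, ae_restrict_mem hS.measurableSet] with y hy hyS
    have : 0 < Real.sqrt (metricMatrix p y).det :=
      Real.sqrt_pos.2 (metricMatrix_posDef p hyS.1).det_pos
    simp only [Pi.zero_apply, ENNReal.ofReal_eq_zero] at hy
    exact absurd this (not_lt.2 hy)
  rw [eventually_false_iff_eq_bot, ae_eq_bot, Measure.restrict_eq_zero] at h1
  exact (hS.measure_pos volume hSne).ne' h1

end Volume

/-! ### Properness of complete Riemannian manifolds -/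

section HopfRinow

/-- The Hopf–Rinow theorem in the form of Cohn-Vossen: a complete, locally compact length space is
proper. The length condition is used in the form that a point at distance less than `a + b`
from `x` lies within `b` of the closed ball of radius `a`. -/
theorem ProperSpace.of_complete_of_length {X : Type*} [MetricSpace X] [CompleteSpace X]
    [LocallyCompactSpace X]
    (hlen : ∀ (x y : X) (a b : ℝ), 0 ≤ a → 0 < b → dist x y < a + b →
      ∃ z, dist x z ≤ a ∧ dist z y < b) : ProperSpace X := by
  refine ⟨fun x r => ?_⟩
  by_contra hr
  let S : Set ℝ := {s | 0 ≤ s ∧ IsCompact (Metric.closedBall x s)}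
  have hmono : ∀ s t, t ≤ s → IsCompact (Metric.closedBall x s) →
      IsCompact (Metric.closedBall x t) := fun s t hts hs =>
    hs.of_isClosed_subset Metric.isClosed_closedBall (Metric.closedBall_subset_closedBall hts)
  have h0 : (0 : ℝ) ∈ S := ⟨le_rfl, by simp⟩
  have hbdd : BddAbove S := by
    refine ⟨r, fun s hs => ?_⟩
    by_contra h
    exact hr (hmono s r (not_le.1 h).le hs.2)
  set R := sSup S with hR
  have hR0 : 0 ≤ R := le_csSup hbdd h0
  have hlt : ∀ t, t < R → IsCompact (Metric.closedBall x t) := by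
    intro t ht
    obtain ⟨s, hs, hts⟩ := exists_lt_of_lt_csSup ⟨0, h0⟩ ht
    exact hmono s t hts.le hs.2
  -- the supremum of the radii of compact balls is attained, by completeness
  have hcR : IsCompact (Metric.closedBall x R) := by
    refine isCompact_iff_totallyBounded_isComplete.2 ⟨?_, Metric.isClosed_closedBall.isComplete⟩
    rw [Metric.totallyBounded_iff]
    intro ε hε
    have hc : IsCompact (Metric.closedBall x (max 0 (R - ε / 4))) := by
      rcases le_total (R - ε / 4) 0 with h | h
      · rw [max_eq_left h]; exact h0.2
      · rw [max_eq_right h]; exact hlt _ (by linarith)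
    obtain ⟨t, ht, hcov⟩ := Metric.totallyBounded_iff.1 hc.totallyBounded (ε / 2) (by linarith)
    refine ⟨t, ht, fun y hy => ?_⟩
    have hd : dist x y < max 0 (R - ε / 4) + ε / 2 := by
      have := le_max_right 0 (R - ε / 4)
      rw [Metric.mem_closedBall, dist_comm] at hy
      linarith
    obtain ⟨z, hz, hzy⟩ := hlen x y _ _ (le_max_left _ _) (by linarith) hd
    have hz' := hcov (Metric.mem_closedBall.2 ((dist_comm z x).trans_le hz))
    simp only [mem_iUnion, Metric.mem_ball, exists_prop] at hz' ⊢
    obtain ⟨w, hw, hzw⟩ := hz'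
    refine ⟨w, hw, ?_⟩
    have := dist_triangle y z w
    rw [dist_comm y z] at this
    linarith
  -- and can be increased, by local compactness
  obtain ⟨K, hK, hRK⟩ := exists_compact_superset hcR
  obtain ⟨δ, hδ, hthick⟩ := hcR.exists_cthickening_subset_open isOpen_interior hRK
  have hcomp : IsCompact (Metric.closedBall x (R + δ / 2)) := by
    refine hK.of_isClosed_subset Metric.isClosed_closedBall fun y hy => ?_
    rw [Metric.mem_closedBall, dist_comm] at hy
    obtain ⟨z, hz, hzy⟩ := hlen x y R δ hR0 hδ (by linarith)
    refine interior_subset (hthick ?_)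
    refine Metric.mem_cthickening_of_dist_le y z δ _ ?_ ((dist_comm y z).trans_le hzy.le)
    exact Metric.mem_closedBall.2 ((dist_comm z x).trans_le hz)
  have := le_csSup hbdd (show R + δ / 2 ∈ S from ⟨by linarith, hcomp⟩)
  linarith

/-- The distance of a Riemannian manifold is a length metric: a curve of length less than `a + b`
from `x` to `y` can be cut where it leaves the closed ball of radius `a`. -/
theorem exists_dist_le_dist_lt (n : ℕ) {M : Type*} [MetricSpace M]
    [ChartedSpace (EuclideanSpace ℝ (Fin n)) M]
    [RiemannianBundle (fun x : M => TangentSpace (𝓡 n) x)]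
    [IsRiemannianManifold (𝓡 n) M] (x y : M) (a b : ℝ) (ha : 0 ≤ a) (hb : 0 < b)
    (hd : dist x y < a + b) : ∃ z, dist x z ≤ a ∧ dist z y < b := by
  rcases le_or_gt (dist x y) a with h | h
  · exact ⟨y, h, by simpa using hb⟩
  have hr : riemannianEDist (𝓡 n) x y < ENNReal.ofReal (a + b) := by
    rw [← IsRiemannianManifold.out (I := 𝓡 n) x y, edist_dist]
    exact (ENNReal.ofReal_lt_ofReal_iff (by linarith)).2 hd
  obtain ⟨γ, h0, h1, hγ, hlen⟩ := exists_lt_of_riemannianEDist_lt hr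
  have hcont : ContinuousOn (fun t => dist x (γ t)) (Icc 0 1) :=
    (continuous_const.dist continuous_id).comp_continuousOn hγ.continuousOn
  obtain ⟨t, ht, hta⟩ : a ∈ (fun t => dist x (γ t)) '' Icc (0 : ℝ) 1 :=
    intermediate_value_Icc zero_le_one hcont (by simpa [h0, h1] using ⟨ha, h.le⟩)
  refine ⟨γ t, hta.le, ?_⟩
  have e1 : edist x (γ t) ≤ pathELength (𝓡 n) γ 0 t := by
    rw [IsRiemannianManifold.out (I := 𝓡 n) x]
    exact riemannianEDist_le_pathELength (hγ.mono (Icc_subset_Icc_right ht.2)) h0 rfl ht.1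
  have e2 : edist (γ t) y ≤ pathELength (𝓡 n) γ t 1 := by
    rw [IsRiemannianManifold.out (I := 𝓡 n) _ y]
    exact riemannianEDist_le_pathELength (hγ.mono (Icc_subset_Icc_left ht.1)) rfl h1 ht.2
  have e3 := (add_le_add e1 e2).trans_lt ((pathELength_add ht.1 ht.2).trans_lt hlen)
  rw [edist_dist, edist_dist, ← ENNReal.ofReal_add dist_nonneg dist_nonneg,
    ENNReal.ofReal_lt_ofReal_iff (by linarith)] at e3
  have : dist x (γ t) = a := hta
  linarith

theorem properSpace_of_isRiemannianManifold (n : ℕ) (M : Type*) [MetricSpace M]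
    [ChartedSpace (EuclideanSpace ℝ (Fin n)) M]
    [RiemannianBundle (fun x : M => TangentSpace (𝓡 n) x)]
    [IsRiemannianManifold (𝓡 n) M] [CompleteSpace M] : ProperSpace M := by
  have : LocallyCompactSpace M := ChartedSpace.locallyCompactSpace (EuclideanSpace ℝ (Fin n)) M
  exact .of_complete_of_length (exists_dist_le_dist_lt n)

end HopfRinow

/-! ### Riemannian distance and charts -/

section Lipschitz

variable {n : ℕ} {M : Type*} [MetricSpace M] [ChartedSpace (EuclideanSpace ℝ (Fin n)) M]
  [RiemannianBundle (fun x : M => TangentSpace (𝓡 n) x)]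

theorem norm_mfderiv_chart_symm (p : M) (y v : EuclideanSpace ℝ (Fin n)) :
    ‖mfderiv 𝓘(ℝ, EuclideanSpace ℝ (Fin n)) (𝓡 n) (extChartAt (𝓡 n) p).symm y v‖
      = Real.sqrt (∑ i, ∑ j, v i * v j * metricMatrix p y i j) := by
  rw [← inner_mfderiv_chart_symm, real_inner_self_eq_norm_sq, Real.sqrt_sq (norm_nonneg _)]

variable [IsManifold (𝓡 n) ∞ M]

/-- The Riemannian distance between the endpoints of a coordinate segment is at most the length of
the segment. -/
theorem dist_chart_symm_le [IsRiemannianManifold (𝓡 n) M] {p : M}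
    {y v : EuclideanSpace ℝ (Fin n)} {t c : ℝ} (ht : 0 ≤ t)
    (hseg : ∀ s ∈ Icc 0 t, y + s • v ∈ (extChartAt (𝓡 n) p).target)
    (hc : ∀ s ∈ Icc 0 t, ‖mfderiv 𝓘(ℝ, EuclideanSpace ℝ (Fin n)) (𝓡 n)
      (extChartAt (𝓡 n) p).symm (y + s • v) v‖ ≤ c) :
    dist ((extChartAt (𝓡 n) p).symm y) ((extChartAt (𝓡 n) p).symm (y + t • v)) ≤ c * t := by
  have hc0 : 0 ≤ c := (norm_nonneg _).trans (hc 0 ⟨le_rfl, ht⟩)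
  let η : ℝ → EuclideanSpace ℝ (Fin n) := fun s => y + s • v
  have hη : ContDiff ℝ 1 η := by fun_prop
  have hηd : ∀ s, HasDerivAt η v s := fun s => by
    have := ((hasDerivAt_id s).smul_const v).const_add y
    rwa [one_smul] at this
  have hγ : ContMDiffOn 𝓘(ℝ, ℝ) (𝓡 n) 1 ((extChartAt (𝓡 n) p).symm ∘ η) (Icc 0 t) := by
    have h1 : (1 : ℕ∞ω) ≤ ((⊤ : ℕ∞) : WithTop ℕ∞) := ENat.LEInfty.out
    exact ((contMDiffOn_extChartAt_symm (n := ∞) p).of_le h1).comp hη.contMDiff.contMDiffOn hseg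
  have hle : edist ((extChartAt (𝓡 n) p).symm y) ((extChartAt (𝓡 n) p).symm (y + t • v))
      ≤ ENNReal.ofReal (c * t) := by
    rw [IsRiemannianManifold.out (I := 𝓡 n)]
    refine (riemannianEDist_le_pathELength hγ (by simp [η, -extChartAt])
      (by simp [η, -extChartAt]) ht).trans ?_
    rw [pathELength_eq_lintegral_mfderiv_Ioo]
    calc _ ≤ ∫⁻ _ in Ioo 0 t, ENNReal.ofReal c := by
          refine setLIntegral_mono' measurableSet_Ioo fun s hs => ?_
          have hs' := Ioo_subset_Icc_self hs
          have hcomp := mfderiv_comp s (mdifferentiableAt_chart_symm (n := n) (hseg s hs'))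
            (hηd s).differentiableAt.mdifferentiableAt
          rw [mfderiv_eq_fderiv, (hηd s).hasFDerivAt.fderiv] at hcomp
          have hv := DFunLike.congr_fun hcomp (1 : ℝ)
          refine (congrArg enorm hv).trans_le ?_
          rw [← ofReal_norm]
          refine ENNReal.ofReal_le_ofReal (le_trans (le_of_eq ?_) (hc s hs'))
          refine congrArg (fun w : EuclideanSpace ℝ (Fin n) => ‖mfderiv
            𝓘(ℝ, EuclideanSpace ℝ (Fin n)) (𝓡 n) (extChartAt (𝓡 n) p).symm (y + s • v) w‖) ?_
          exact one_smul ℝ v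
      _ = ENNReal.ofReal (c * t) := by
          rw [lintegral_const, Measure.restrict_apply_univ, Real.volume_Ioo, sub_zero,
            ENNReal.ofReal_mul hc0]
  rw [edist_dist, ENNReal.ofReal_le_ofReal_iff (by positivity)] at hle
  exact hle

variable [IsContMDiffRiemannianBundle (𝓡 n) ∞ (EuclideanSpace ℝ (Fin n))
      (fun x : M => TangentSpace (𝓡 n) x)]

theorem continuousOn_norm_mfderiv_chart_symm (p : M) (v : EuclideanSpace ℝ (Fin n)) :
    ContinuousOn (fun y => ‖mfderiv 𝓘(ℝ, EuclideanSpace ℝ (Fin n)) (𝓡 n)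
      (extChartAt (𝓡 n) p).symm y v‖) (extChartAt (𝓡 n) p).target := by
  simp only [norm_mfderiv_chart_symm]
  refine ContinuousOn.sqrt (continuousOn_finsetSum _ fun i _ => continuousOn_finsetSum _ fun j _ =>
    continuousOn_const.mul (contDiffOn_metricMatrix p i j).continuousOn)

/-- The inverse of a chart is Lipschitz near the centre of the chart. -/
theorem exists_lipschitzOnWith_chart_symm [IsRiemannianManifold (𝓡 n) M] (p : M) :
    ∃ ε > 0, Metric.ball (extChartAt (𝓡 n) p p) ε ⊆ (extChartAt (𝓡 n) p).target ∧
      ∃ C, LipschitzOnWith C (extChartAt (𝓡 n) p).symm (Metric.ball (extChartAt (𝓡 n) p p) ε) := by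
  set y₀ := extChartAt (𝓡 n) p p with hy₀
  have hnhds := (isOpen_extChartAt_target (I := 𝓡 n) p).mem_nhds (mem_extChartAt_target p)
  let K : EuclideanSpace ℝ (Fin n) → ℝ := fun y => ∑ i, ∑ j, |metricMatrix p y i j|
  have hK : ContinuousAt K y₀ :=
    (continuousOn_finsetSum _ fun i _ => continuousOn_finsetSum _ fun j _ =>
      (contDiffOn_metricMatrix p i j).continuousOn.abs).continuousAt hnhds
  obtain ⟨ε, hε, hball⟩ := Metric.mem_nhds_iff.1
    (inter_mem hnhds (hK.eventually (gt_mem_nhds (lt_add_one (K y₀)))))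
  refine ⟨ε, hε, fun y hy => (hball hy).1, Real.toNNReal (Real.sqrt (K y₀ + 1)), ?_⟩
  refine LipschitzOnWith.of_dist_le_mul fun y hy z hz => ?_
  have hconv := (convex_ball y₀ ε).segment_subset hy hz
  have hmem : ∀ s ∈ Icc (0 : ℝ) 1, y + s • (z - y) ∈ Metric.ball y₀ ε := fun s hs =>
    hconv (by rw [segment_eq_image']; exact ⟨s, hs, rfl⟩)
  have h := dist_chart_symm_le (p := p) (y := y) (v := z - y) (t := 1)
    (c := Real.sqrt (K y₀ + 1) * ‖z - y‖) zero_le_one (fun s hs => (hball (hmem s hs)).1)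
    fun s hs => ?_
  · rw [one_smul, add_sub_cancel, mul_one] at h
    rw [Real.coe_toNNReal _ (Real.sqrt_nonneg _), dist_eq_norm y z, norm_sub_rev]
    exact h
  · rw [norm_mfderiv_chart_symm, ← Real.sqrt_sq (norm_nonneg (z - y)),
      ← Real.sqrt_mul' _ (sq_nonneg _)]
    refine Real.sqrt_le_sqrt ?_
    have hlt : K (y + s • (z - y)) < K y₀ + 1 := (hball (hmem s hs)).2
    refine le_trans ?_ (mul_le_mul_of_nonneg_right hlt.le (sq_nonneg _))
    simp only [K, Finset.sum_mul]
    refine Finset.sum_le_sum fun i _ => Finset.sum_le_sum fun j _ => ?_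
    refine (le_abs_self _).trans ?_
    rw [abs_mul, abs_mul, mul_comm, sq]
    gcongr
    · exact PiLp.norm_apply_le (z - y) i
    · exact PiLp.norm_apply_le (z - y) j

/-- If the variation of `f` from `y`, a point with coordinates in the chart around `p`, is at most
`L` times the Riemannian distance, then its directional derivatives at `y` are bounded by `L` times
the Riemannian length of the direction. -/
theorem abs_fderiv_le_of_dist [IsRiemannianManifold (𝓡 n) M] {p : M}
    {y v : EuclideanSpace ℝ (Fin n)} (hy : y ∈ (extChartAt (𝓡 n) p).target)
    {f : EuclideanSpace ℝ (Fin n) → ℝ} {L : ℝ} (hL : 0 ≤ L) (hf : DifferentiableAt ℝ f y)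
    (hlip : ∀ᶠ z in 𝓝 y, |f z - f y| ≤
      L * dist ((extChartAt (𝓡 n) p).symm y) ((extChartAt (𝓡 n) p).symm z)) :
    |fderiv ℝ f y v| ≤ L * ‖mfderiv 𝓘(ℝ, EuclideanSpace ℝ (Fin n)) (𝓡 n)
      (extChartAt (𝓡 n) p).symm y v‖ := by
  have hopen := (isOpen_extChartAt_target (I := 𝓡 n) p).mem_nhds hy
  have hder : HasDerivAt (fun t : ℝ => f (y + t • v)) (fderiv ℝ f y v) 0 := by
    have h1 : HasDerivAt (fun t : ℝ => y + t • v) v 0 := by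
      simpa using ((hasDerivAt_id (0 : ℝ)).smul_const v).const_add y
    refine HasFDerivAt.comp_hasDerivAt (f := fun t : ℝ => y + t • v) (0 : ℝ) ?_ h1
    simpa using hf.hasFDerivAt
  have htend : Tendsto (fun t : ℝ => y + t • v) (𝓝 0) (𝓝 y) := by
    have : ContinuousAt (fun t : ℝ => y + t • v) 0 := by fun_prop
    simpa using this.tendsto
  have key : ∀ c, ‖mfderiv 𝓘(ℝ, EuclideanSpace ℝ (Fin n)) (𝓡 n)
      (extChartAt (𝓡 n) p).symm y v‖ < c → |fderiv ℝ f y v| ≤ L * c := by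
    intro c hc
    have hev : ∀ᶠ z in 𝓝 y, z ∈ (extChartAt (𝓡 n) p).target ∧
        ‖mfderiv 𝓘(ℝ, EuclideanSpace ℝ (Fin n)) (𝓡 n) (extChartAt (𝓡 n) p).symm z v‖ < c :=
      (eventually_mem_set.2 hopen).and
        (((continuousOn_norm_mfderiv_chart_symm p v).continuousAt hopen).eventually
          (gt_mem_nhds hc))
    have hev' : ∀ᶠ t in 𝓝 (0 : ℝ), (y + t • v ∈ (extChartAt (𝓡 n) p).target ∧
        ‖mfderiv 𝓘(ℝ, EuclideanSpace ℝ (Fin n)) (𝓡 n) (extChartAt (𝓡 n) p).symm (y + t • v) v‖ < c)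
        ∧ |f (y + t • v) - f y| ≤ L * dist ((extChartAt (𝓡 n) p).symm y)
          ((extChartAt (𝓡 n) p).symm (y + t • v)) :=
      htend.eventually (hev.and hlip)
    obtain ⟨δ, hδ, hball⟩ := Metric.eventually_nhds_iff_ball.1 hev'
    have hslope := hder.tendsto_slope_zero_right.abs
    refine le_of_tendsto hslope ?_
    filter_upwards [Ioo_mem_nhdsGT hδ] with t ht
    have hmem : ∀ s ∈ Icc 0 t, s ∈ Metric.ball (0 : ℝ) δ := fun s hs => by
      rw [Metric.mem_ball, Real.dist_eq, sub_zero, abs_of_nonneg hs.1]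
      exact hs.2.trans_lt ht.2
    have hd := dist_chart_symm_le (p := p) ht.1.le (fun s hs => (hball s (hmem s hs)).1.1)
      fun s hs => (hball s (hmem s hs)).1.2.le
    have hb := (hball t (hmem t ⟨ht.1.le, le_rfl⟩)).2
    simp only [zero_add, zero_smul, add_zero, smul_eq_mul]
    rw [abs_mul, abs_inv, abs_of_pos ht.1, inv_mul_le_iff₀ ht.1]
    calc _ ≤ _ := hb
      _ ≤ L * (c * t) := by gcongr
      _ = _ := by ring
  refine le_of_forall_pos_le_add fun ε hε => ?_
  have := key (‖mfderiv 𝓘(ℝ, EuclideanSpace ℝ (Fin n)) (𝓡 n)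
      (extChartAt (𝓡 n) p).symm y v‖ + ε / (L + 1)) (by have : 0 < ε / (L + 1) := by positivity
                                                        linarith)
  refine this.trans ?_
  rw [mul_add]
  gcongr
  rw [mul_div_assoc', div_le_iff₀ (by positivity)]
  nlinarith

end Lipschitz

/-! ### Integration by parts for Lipschitz functions in a chart -/

section FlatDivergence

variable {n : ℕ}

/-- Integration by parts against a Lipschitz function, for a compactly supported `C¹` vector
field on Euclidean space. -/
theorem LipschitzWith.integral_divergence_mul {C : NNReal} {f : EuclideanSpace ℝ (Fin n) → ℝ}
    (hf : LipschitzWith C f) {w : EuclideanSpace ℝ (Fin n) → EuclideanSpace ℝ (Fin n)}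
    (hw : ContDiff ℝ 1 w) (hcs : HasCompactSupport w) :
    ∫ y, f y * ∑ c, partialDeriv c (fun z => w z c) y = -∫ y, fderiv ℝ f y (w y) := by
  have hwc : ∀ c, ContDiff ℝ 1 fun z => w z c := fun c =>
    (EuclideanSpace.proj c : EuclideanSpace ℝ (Fin n) →L[ℝ] ℝ).contDiff.comp hw
  have hcsc : ∀ c, HasCompactSupport fun z => w z c := fun c =>
    hcs.comp_left (g := fun v : EuclideanSpace ℝ (Fin n) => v c) rfl
  have hLip : ∀ c, ∃ D, LipschitzWith D fun z => w z c := fun c =>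
    ContDiff.lipschitzWith_of_hasCompactSupport (hcsc c) (hwc c) one_ne_zero
  have hpd : ∀ c, Continuous (partialDeriv c fun z => w z c) := fun c =>
    ((hwc c).continuous_fderiv one_ne_zero).clm_apply continuous_const
  have hpdcs : ∀ c, HasCompactSupport (partialDeriv c fun z => w z c) := fun c =>
    (hcsc c).fderiv_apply (𝕜 := ℝ) _
  have hsplit : ∀ᵐ y, fderiv ℝ f y (w y)
      = ∑ c, lineDeriv ℝ f y (EuclideanSpace.single c (1 : ℝ)) * w y c := by
    filter_upwards [hf.ae_differentiableAt] with y hy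
    conv_lhs => rw [EuclideanSpace.eq_sum_single (w y)]
    rw [map_sum]
    refine Finset.sum_congr rfl fun c _ => ?_
    rw [map_smul, smul_eq_mul, hy.lineDeriv_eq_fderiv, mul_comm]
  have hint : ∀ c, Integrable fun y => lineDeriv ℝ f y (EuclideanSpace.single c (1 : ℝ)) * w y c :=
    fun c => ((hwc c).continuous.integrable_of_hasCompactSupport (hcsc c)).bdd_mul
      (c := C * ‖EuclideanSpace.single c (1 : ℝ)‖)
      (measurable_lineDeriv hf.continuous).aestronglyMeasurable
      (Eventually.of_forall fun y => norm_lineDeriv_le_of_lipschitz ℝ hf)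
  rw [integral_congr_ae hsplit, integral_finsetSum _ fun c _ => hint c, ← Finset.sum_neg_distrib]
  simp only [Finset.mul_sum]
  have hint' : ∀ c, Integrable fun y => f y * partialDeriv c (fun z => w z c) y := fun c =>
    (hf.continuous.mul (hpd c)).integrable_of_hasCompactSupport ((hpdcs c).mul_left)
  rw [integral_finsetSum _ fun c _ => hint' c]
  refine Finset.sum_congr rfl fun c _ => ?_
  obtain ⟨D, hD⟩ := hLip c
  rw [hf.integral_lineDeriv_mul_eq hD (hcsc c), ← integral_neg]
  refine integral_congr_ae (Eventually.of_forall fun y => ?_)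
  have hd : DifferentiableAt ℝ (fun z => w z c) y := (hwc c).differentiable one_ne_zero y
  simp only
  rw [hd.lineDeriv_eq_fderiv, map_neg, partialDeriv]
  ring

end FlatDivergence

section ChartDivergence

variable {n : ℕ} {M : Type*} [MetricSpace M] [ChartedSpace (EuclideanSpace ℝ (Fin n)) M]
  [IsManifold (𝓡 n) ∞ M]

theorem fderiv_comp_chart_symm {p : M} {y : EuclideanSpace ℝ (Fin n)}
    (hy : y ∈ (extChartAt (𝓡 n) p).target) (X : Π x : M, TangentSpace (𝓡 n) x) {ρ : M → ℝ}
    (hρ : ContMDiff (𝓡 n) 𝓘(ℝ, ℝ) ∞ ρ) :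
    fderiv ℝ (ρ ∘ (extChartAt (𝓡 n) p).symm) y (coordVec p X y)
      = mvfderiv (𝓡 n) ρ ((extChartAt (𝓡 n) p).symm y) (X ((extChartAt (𝓡 n) p).symm y)) := by
  have hc := mfderiv_comp y ((hρ ((extChartAt (𝓡 n) p).symm y)).mdifferentiableAt (by simp))
    (mdifferentiableAt_chart_symm (n := n) hy)
  have h3 := DFunLike.congr_fun hc (coordVec p X y)
  rw [mfderiv_eq_fderiv] at h3
  rw [← mfderiv_chart_symm_coordVec hy X]
  exact h3

theorem contDiffOn_comp_chart_symm (p : M) {ρ : M → ℝ} (hρ : ContMDiff (𝓡 n) 𝓘(ℝ, ℝ) ∞ ρ) :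
    ContDiffOn ℝ ∞ (ρ ∘ (extChartAt (𝓡 n) p).symm) (extChartAt (𝓡 n) p).target :=
  fun _ hy => ((hρ _).comp _ (contMDiffAt_chart_symm hy)).contDiffAt.contDiffWithinAt

/-- A function on `M` is continuous if all its expressions in charts are. -/
theorem continuous_of_comp_chart_symm (n : ℕ) {M : Type*} [TopologicalSpace M]
    [ChartedSpace (EuclideanSpace ℝ (Fin n)) M] {f : M → ℝ}
    (hf : ∀ p : M, ContinuousOn (fun y => f ((extChartAt (𝓡 n) p).symm y))
      (extChartAt (𝓡 n) p).target) : Continuous f := by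
  refine continuous_iff_continuousAt.2 fun p => ?_
  have h := (hf p).continuousAt ((isOpen_extChartAt_target p).mem_nhds (mem_extChartAt_target p))
  have h2 := ContinuousAt.comp (f := extChartAt (𝓡 n) p) h (continuousAt_extChartAt (I := 𝓡 n) p)
  refine h2.congr ?_
  filter_upwards [extChartAt_source_mem_nhds (I := 𝓡 n) p] with x hx
  simp only [Function.comp_apply]
  rw [(extChartAt (𝓡 n) p).left_inv hx]

theorem continuous_mvfderiv_apply {X : Π x : M, TangentSpace (𝓡 n) x}
    (hX : IsSmoothVectorField X) {ρ : M → ℝ} (hρ : ContMDiff (𝓡 n) 𝓘(ℝ, ℝ) ∞ ρ) :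
    Continuous fun x => mvfderiv (𝓡 n) ρ x (X x) := by
  refine continuous_of_comp_chart_symm n fun p => ?_
  have h : ContinuousOn (fun y => fderiv ℝ (ρ ∘ (extChartAt (𝓡 n) p).symm) y (coordVec p X y))
      (extChartAt (𝓡 n) p).target :=
    ((contDiffOn_comp_chart_symm p hρ).continuousOn_fderiv_of_isOpen
      (isOpen_extChartAt_target p) (by simp)).clm_apply (contDiffOn_coordVec p hX).continuousOn
  exact h.congr fun y hy => (fderiv_comp_chart_symm hy X hρ).symm

variable [RiemannianBundle (fun x : M => TangentSpace (𝓡 n) x)]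

/-- `X` is a conformal field with factor `φ`: `½ 𝓛_X g = φ g`. -/
def IsConformalField (X : Π x : M, TangentSpace (𝓡 n) x) (φ : M → ℝ) : Prop :=
  ∀ Y Z : Π x : M, TangentSpace (𝓡 n) x, IsSmoothVectorField Y → IsSmoothVectorField Z →
    ∀ x, 1 / 2 * lieDerivMetric X Y Z x = φ x * inner ℝ (Y x) (Z x)

variable [IsContMDiffRiemannianBundle (𝓡 n) ∞ (EuclideanSpace ℝ (Fin n))
      (fun x : M => TangentSpace (𝓡 n) x)]

/-- The divergence of a conformal field with factor `φ` is `n φ`, in coordinates. -/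
theorem IsConformalField.divergence_coord {X : Π x : M, TangentSpace (𝓡 n) x} {φ : M → ℝ}
    (hφ : IsConformalField X φ) (hX : IsSmoothVectorField X) {p : M}
    {y : EuclideanSpace ℝ (Fin n)} (hy : y ∈ (extChartAt (𝓡 n) p).target) :
    ∑ c, partialDeriv c (fun z => Real.sqrt (metricMatrix p z).det * coordVec p X z c) y
      = n * φ ((extChartAt (𝓡 n) p).symm y) * Real.sqrt (metricMatrix p y).det := by
  have hnhds := (isOpen_extChartAt_target (I := 𝓡 n) p).mem_nhds hy
  refine sum_partialDeriv_sqrt_det_mul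
    (fun i j => ((contDiffOn_metricMatrix p i j).contDiffAt hnhds).differentiableAt (by simp))
    (((contDiffOn_coordVec p hX).contDiffAt hnhds).differentiableAt (by simp))
    (metricMatrix_posDef p hy) fun a b => ?_
  obtain ⟨Y, hY, hYe⟩ := exists_smooth_extension_const hy (EuclideanSpace.single a (1 : ℝ))
  obtain ⟨Z, hZ, hZe⟩ := exists_smooth_extension_const hy (EuclideanSpace.single b (1 : ℝ))
  rw [← lieDerivMetric_coord hX hy hY hZ a b hYe hZe]
  have h := hφ Y Z hY hZ ((extChartAt (𝓡 n) p).symm y)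
  rw [hYe.self_of_nhds, hZe.self_of_nhds] at h
  have h2 : metricMatrix p y a b = inner ℝ (coordField p a y) (coordField p b y) := rfl
  rw [h2, coordField, coordField, mul_assoc, ← h]
  ring

theorem IsConformalField.continuous [NeZero n] {X : Π x : M, TangentSpace (𝓡 n) x} {φ : M → ℝ}
    (hφ : IsConformalField X φ) (hX : IsSmoothVectorField X) : Continuous φ := by
  refine continuous_of_comp_chart_symm n fun p => ?_
  have hopen := isOpen_extChartAt_target (I := 𝓡 n) p
  have hG := contDiffOn_sqrt_det_metricMatrix (n := n) p
  have hGpos : ∀ y ∈ (extChartAt (𝓡 n) p).target, 0 < Real.sqrt (metricMatrix p y).det :=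
    fun y hy => Real.sqrt_pos.2 (metricMatrix_posDef p hy).det_pos
  have hD : ContinuousOn (fun y => ∑ c, partialDeriv c
      (fun z => Real.sqrt (metricMatrix p z).det * coordVec p X z c) y)
      (extChartAt (𝓡 n) p).target := by
    refine continuousOn_finsetSum _ fun c _ => ?_
    have hV : ContDiffOn ℝ ∞ (fun z => coordVec p X z c) (extChartAt (𝓡 n) p).target :=
      (EuclideanSpace.proj c : EuclideanSpace ℝ (Fin n) →L[ℝ] ℝ).contDiff.comp_contDiffOn
        (contDiffOn_coordVec p hX)
    exact ((hG.mul hV).continuousOn_fderiv_of_isOpen hopen (by simp)).clm_apply continuousOn_const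
  have hn : (n : ℝ) ≠ 0 := Nat.cast_ne_zero.2 (NeZero.ne n)
  refine (hD.div (continuousOn_const.mul hG.continuousOn)
    fun y hy => mul_ne_zero hn (hGpos y hy).ne').congr fun y hy => ?_
  rw [Pi.div_apply, hφ.divergence_coord hX hy]
  exact (eq_div_iff (mul_ne_zero hn (hGpos y hy).ne')).2 (by ring)

end ChartDivergence

/-! ### The divergence theorem for conformal fields -/

section LocalDivergence

variable {n : ℕ} {M : Type*} [MetricSpace M] [ChartedSpace (EuclideanSpace ℝ (Fin n)) M]
  [IsManifold (𝓡 n) ∞ M]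
  [RiemannianBundle (fun x : M => TangentSpace (𝓡 n) x)]
  [IsContMDiffRiemannianBundle (𝓡 n) ∞ (EuclideanSpace ℝ (Fin n))
    (fun x : M => TangentSpace (𝓡 n) x)]

theorem continuous_norm_vectorField {X : Π x : M, TangentSpace (𝓡 n) x}
    (hX : IsSmoothVectorField X) : Continuous fun x => ‖X x‖ := by
  have h : ContMDiff (𝓡 n) 𝓘(ℝ, ℝ) ∞ fun x => (inner ℝ (X x) (X x) : ℝ) :=
    fun x => ContMDiffAt.inner_bundle (hX x) (hX x)
  refine h.continuous.sqrt.congr fun x => ?_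
  rw [real_inner_self_eq_norm_sq, Real.sqrt_sq (norm_nonneg _)]

variable [SecondCountableTopology M] [MeasurableSpace M] [BorelSpace M]

/-- The divergence theorem against a Lipschitz function `ψ`, localized in a chart by a smooth cutoff
`ρ`. The function `b` bounds the local Lipschitz constant of `ψ`, hence the norm of its gradient;
the gradient itself exists only almost everywhere and does not appear. -/
theorem IsConformalField.localized_divergence_le [NeZero n] [IsRiemannianManifold (𝓡 n) M]
    {X : Π x : M, TangentSpace (𝓡 n) x} {φ : M → ℝ}
    (hφ : IsConformalField X φ) (hX : IsSmoothVectorField X) {p : M}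
    {B : Set (EuclideanSpace ℝ (Fin n))}
    (hBt : B ⊆ (extChartAt (𝓡 n) p).target) (hBo : IsOpen B) {C : NNReal}
    (hC : LipschitzOnWith C (extChartAt (𝓡 n) p).symm B)
    {ρ : M → ℝ} (hρ : ContMDiff (𝓡 n) 𝓘(ℝ, ℝ) ∞ ρ) (hρ0 : ∀ x, 0 ≤ ρ x)
    (hρc : HasCompactSupport ρ)
    (hρB : tsupport ρ ⊆ (extChartAt (𝓡 n) p).source ∩ extChartAt (𝓡 n) p ⁻¹' B)
    {ψ : M → ℝ} {L : NNReal} (hψ : LipschitzWith L ψ) {b : M → ℝ} (hb : Measurable b)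
    (hb0 : ∀ x, 0 ≤ b x) (hψb : ∀ x, ∀ᶠ z in 𝓝 x, |ψ z - ψ x| ≤ b x * dist x z) :
    ENNReal.ofReal (∫ x, ψ x * (n * φ x * ρ x + mvfderiv (𝓡 n) ρ x (X x)) ∂(riemannianVolume n M))
      ≤ ∫⁻ x, ENNReal.ofReal (ρ x * (b x * ‖X x‖)) ∂(riemannianVolume n M) := by
  classical
  set T := (extChartAt (𝓡 n) p).target with hT
  have hTo : IsOpen T := isOpen_extChartAt_target p
  have hTm : MeasurableSet T := hTo.measurableSet
  have hG := contDiffOn_sqrt_det_metricMatrix (n := n) p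
  have hV := contDiffOn_coordVec p hX
  have hρΦ := contDiffOn_comp_chart_symm p hρ
  have hρsrc : ∀ x, x ∉ (extChartAt (𝓡 n) p).source → x ∉ tsupport ρ := fun x hx h =>
    hx (hρB h).1
  -- `K` is the support of `ρ` in the chart and `w` the compactly supported field `ρ √(det g) X`
  let K := extChartAt (𝓡 n) p '' tsupport ρ
  have hKB : K ⊆ B := by
    rintro _ ⟨x, hx, rfl⟩
    exact (hρB hx).2
  have hK : IsCompact K := hρc.isCompact.image_of_continuousOn
    ((continuousOn_extChartAt p).mono fun x hx => (hρB hx).1)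
  have hKmem : ∀ y ∈ T, y ∉ K → (extChartAt (𝓡 n) p).symm y ∉ tsupport ρ := fun y hy hyK h =>
    hyK ⟨_, h, (extChartAt (𝓡 n) p).right_inv hy⟩
  let w : EuclideanSpace ℝ (Fin n) → EuclideanSpace ℝ (Fin n) := T.indicator fun y =>
    (ρ ((extChartAt (𝓡 n) p).symm y) * Real.sqrt (metricMatrix p y).det) • coordVec p X y
  have hw0 : ∀ y, y ∉ K → w y = 0 := by
    intro y hy
    by_cases hyT : y ∈ T
    · simp only [w, indicator_of_mem hyT]
      rw [image_eq_zero_of_notMem_tsupport (hKmem y hyT hy), zero_mul, zero_smul]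
    · exact indicator_of_notMem hyT _
  have hw : ContDiff ℝ 1 w := by
    refine contDiff_iff_contDiffAt.2 fun y => ?_
    by_cases hyT : y ∈ T
    · have h1 : ContDiffOn ℝ ∞ (fun y => (ρ ((extChartAt (𝓡 n) p).symm y) *
        Real.sqrt (metricMatrix p y).det) • coordVec p X y) T := (hρΦ.mul hG).smul hV
      refine ((h1.contDiffAt (hTo.mem_nhds hyT)).congr_of_eventuallyEq ?_).of_le
        (show (1 : ℕ∞ω) ≤ ((⊤ : ℕ∞) : WithTop ℕ∞) from ENat.LEInfty.out)
      filter_upwards [hTo.mem_nhds hyT] with z hz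
      exact indicator_of_mem hz _
    · have hyK : y ∉ K := fun h => hyT (hBt (hKB h))
      refine (contDiffAt_const (c := (0 : EuclideanSpace ℝ (Fin n)))).congr_of_eventuallyEq ?_
      filter_upwards [hK.isClosed.isOpen_compl.mem_nhds hyK] with z hz
      exact hw0 z hz
  have hwcs : HasCompactSupport w := HasCompactSupport.intro hK fun y hy => hw0 y hy
  -- the divergence of `w`
  have hdivw : ∀ y ∈ T, ∑ c, partialDeriv c (fun z => w z c) y = Real.sqrt (metricMatrix p y).det *
      (n * φ ((extChartAt (𝓡 n) p).symm y) * ρ ((extChartAt (𝓡 n) p).symm y) +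
        mvfderiv (𝓡 n) ρ ((extChartAt (𝓡 n) p).symm y) (X ((extChartAt (𝓡 n) p).symm y))) := by
    intro y hy
    have hn := hTo.mem_nhds hy
    have hρd : DifferentiableAt ℝ (ρ ∘ (extChartAt (𝓡 n) p).symm) y :=
      (hρΦ.contDiffAt hn).differentiableAt (by simp)
    have hGVd : ∀ c, DifferentiableAt ℝ
        (fun z => Real.sqrt (metricMatrix p z).det * coordVec p X z c) y := fun c =>
      ((hG.contDiffAt hn).differentiableAt (by simp)).mul
        ((EuclideanSpace.proj c : EuclideanSpace ℝ (Fin n) →L[ℝ] ℝ).differentiableAt.comp y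
          ((hV.contDiffAt hn).differentiableAt (by simp)))
    have hc : ∀ c, partialDeriv c (fun z => w z c) y
        = ρ ((extChartAt (𝓡 n) p).symm y) *
            partialDeriv c (fun z => Real.sqrt (metricMatrix p z).det * coordVec p X z c) y
          + Real.sqrt (metricMatrix p y).det * (coordVec p X y c *
            fderiv ℝ (ρ ∘ (extChartAt (𝓡 n) p).symm) y (EuclideanSpace.single c (1 : ℝ))) := by
      intro c
      have he : (fun z => w z c) =ᶠ[𝓝 y] fun z => (ρ ∘ (extChartAt (𝓡 n) p).symm) z *
          (Real.sqrt (metricMatrix p z).det * coordVec p X z c) := by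
        filter_upwards [hn] with z hz
        simp only [w, indicator_of_mem hz, PiLp.smul_apply, smul_eq_mul, Function.comp_apply]
        ring
      rw [partialDeriv, he.fderiv_eq, fderiv_fun_mul hρd (hGVd c)]
      change (ρ ∘ (extChartAt (𝓡 n) p).symm) y * partialDeriv c _ y
        + (Real.sqrt (metricMatrix p y).det * coordVec p X y c) * _ = _
      rw [Function.comp_apply, mul_assoc]
      rfl
    simp only [hc]
    rw [Finset.sum_add_distrib, ← Finset.mul_sum, ← Finset.mul_sum, hφ.divergence_coord hX hy,
      ← fderiv_comp_chart_symm hy X hρ]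
    conv_rhs => rw [EuclideanSpace.eq_sum_single (coordVec p X y), map_sum]
    simp only [map_smul, smul_eq_mul]
    ring
  have hdivw0 : ∀ y, y ∉ K → ∑ c, partialDeriv c (fun z => w z c) y = 0 := by
    intro y hy
    refine Finset.sum_eq_zero fun c _ => ?_
    have he : (fun z => w z c) =ᶠ[𝓝 y] fun _ => 0 := by
      filter_upwards [hK.isClosed.isOpen_compl.mem_nhds hy] with z hz
      rw [hw0 z hz]; rfl
    rw [partialDeriv, he.fderiv_eq]
    simp
  -- `ψ` in the chart, extended to a Lipschitz function on Euclidean space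
  obtain ⟨ψ', hψ', hψeq⟩ := (hψ.comp_lipschitzOnWith hC).extend_real
  have hmain := hψ'.integral_divergence_mul hw hwcs
  have hcont : Continuous fun x => ψ x * (n * φ x * ρ x + mvfderiv (𝓡 n) ρ x (X x)) :=
    hψ.continuous.mul (((continuous_const.mul (hφ.continuous hX)).mul hρ.continuous).add
      (continuous_mvfderiv_apply hX hρ))
  have hsupp : ∀ x, x ∉ tsupport ρ → mvfderiv (𝓡 n) ρ x (X x) = 0 := by
    intro x hx
    have he : ρ =ᶠ[𝓝 x] fun _ => 0 := by
      filter_upwards [(isClosed_tsupport ρ).isOpen_compl.mem_nhds hx] with z hz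
      exact image_eq_zero_of_notMem_tsupport hz
    have := he.mfderiv_eq (I := 𝓡 n) (I' := 𝓘(ℝ, ℝ))
    rw [mfderiv_const] at this
    exact DFunLike.congr_fun this (X x)
  have hlhs : ∫ x, ψ x * (n * φ x * ρ x + mvfderiv (𝓡 n) ρ x (X x)) ∂(riemannianVolume n M)
      = ∫ y, ψ' y * ∑ c, partialDeriv c (fun z => w z c) y := by
    rw [integral_riemannianVolume_of_support p hcont fun x hx => by
      rw [hsupp x (hρsrc x hx), image_eq_zero_of_notMem_tsupport (hρsrc x hx)]; ring]
    have hr : ∫ y in T, ψ' y * ∑ c, partialDeriv c (fun z => w z c) y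
        = ∫ y, ψ' y * ∑ c, partialDeriv c (fun z => w z c) y :=
      setIntegral_eq_integral_of_forall_compl_eq_zero fun y hy => by
        rw [hdivw0 y fun h => hy (hBt (hKB h)), mul_zero]
    rw [← hr]
    refine setIntegral_congr_fun hTm fun y hy => ?_
    simp only
    by_cases hyK : y ∈ K
    · rw [hdivw y hy, ← hψeq (hKB hyK), Function.comp_apply]
      ring
    · have h1 := hdivw y hy
      have h0 := hdivw0 y hyK
      rw [h0] at h1 ⊢
      rw [mul_zero, mul_left_comm, ← h1, mul_zero]
  have hmeas : Measurable fun x => ENNReal.ofReal (ρ x * (b x * ‖X x‖)) :=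
    (hρ.continuous.measurable.mul
      (hb.mul (continuous_norm_vectorField hX).measurable)).ennreal_ofReal
  rw [hlhs, hmain, ← integral_neg, lintegral_riemannianVolume_of_support p hmeas fun x hx => by
      rw [image_eq_zero_of_notMem_tsupport (hρsrc x hx), zero_mul, ENNReal.ofReal_zero],
    ← lintegral_indicator hTm]
  refine (ENNReal.ofReal_le_ofReal (le_abs_self _)).trans ?_
  rw [← Real.norm_eq_abs, ofReal_norm]
  refine (enorm_integral_le_lintegral_enorm _).trans (lintegral_mono_ae ?_)
  filter_upwards [hψ'.ae_differentiableAt] with y hd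
  by_cases hyK : y ∈ K
  swap
  · rw [hw0 y hyK]; simp
  have hyB := hKB hyK
  have hyT := hBt hyB
  have hbound : |fderiv ℝ ψ' y (coordVec p X y)| ≤ b ((extChartAt (𝓡 n) p).symm y) *
      ‖X ((extChartAt (𝓡 n) p).symm y)‖ := by
    rw [← mfderiv_chart_symm_coordVec hyT X]
    refine abs_fderiv_le_of_dist hyT (hb0 _) hd ?_
    filter_upwards [hBo.mem_nhds hyB,
      (continuousAt_extChartAt_symm'' hyT).eventually (hψb ((extChartAt (𝓡 n) p).symm y))]
      with z hzB hz
    rw [← hψeq hzB, ← hψeq hyB]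
    exact hz
  rw [indicator_of_mem hyT, ← ofReal_norm, ← ENNReal.ofReal_mul (Real.sqrt_nonneg _)]
  refine ENNReal.ofReal_le_ofReal ?_
  simp only [w, indicator_of_mem hyT]
  rw [norm_neg, map_smul, norm_smul, Real.norm_eq_abs, Real.norm_eq_abs,
    abs_of_nonneg (mul_nonneg (hρ0 _) (Real.sqrt_nonneg _))]
  calc _ ≤ ρ ((extChartAt (𝓡 n) p).symm y) * Real.sqrt (metricMatrix p y).det *
        (b ((extChartAt (𝓡 n) p).symm y) * ‖X ((extChartAt (𝓡 n) p).symm y)‖) :=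
        mul_le_mul_of_nonneg_left hbound (mul_nonneg (hρ0 _) (Real.sqrt_nonneg _))
    _ = _ := by ring

/-- The divergence theorem for a conformal field against a compactly supported Lipschitz
function. -/
theorem IsConformalField.integral_mul_le [NeZero n] [IsRiemannianManifold (𝓡 n) M]
    {X : Π x : M, TangentSpace (𝓡 n) x} {φ : M → ℝ}
    (hφ : IsConformalField X φ) (hX : IsSmoothVectorField X)
    {ψ : M → ℝ} {L : NNReal} (hψ : LipschitzWith L ψ) (hψc : HasCompactSupport ψ)
    {b : M → ℝ} (hb : Measurable b)
    (hb0 : ∀ x, 0 ≤ b x) (hψb : ∀ x, ∀ᶠ z in 𝓝 x, |ψ z - ψ x| ≤ b x * dist x z) :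
    ENNReal.ofReal (∫ x, ψ x * (n * φ x) ∂(riemannianVolume n M))
      ≤ ∫⁻ x, ENNReal.ofReal (b x * ‖X x‖) ∂(riemannianVolume n M) := by
  classical
  have : LocallyCompactSpace M := ChartedSpace.locallyCompactSpace (EuclideanSpace ℝ (Fin n)) M
  choose ε hε hball C hC using fun p : M => exists_lipschitzOnWith_chart_symm (n := n) p
  let U : M → Set M := fun p => (extChartAt (𝓡 n) p).source ∩
    extChartAt (𝓡 n) p ⁻¹' Metric.ball (extChartAt (𝓡 n) p p) (ε p)
  have hUo : ∀ p, IsOpen (U p) := fun p => (continuousOn_extChartAt p).isOpen_inter_preimage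
    (isOpen_extChartAt_source p) Metric.isOpen_ball
  have hUp : ∀ p, p ∈ U p := fun p => ⟨mem_extChartAt_source p, Metric.mem_ball_self (hε p)⟩
  -- relatively compact sets are needed so that the partition of unity has compact supports
  obtain ⟨K, hK, hψK⟩ := exists_compact_superset hψc.isCompact
  obtain ⟨K', hK', hKK'⟩ := exists_compact_superset hK
  obtain ⟨t, ht⟩ := hK.elim_finite_subcover (fun p => U p ∩ interior K')
    (fun p => (hUo p).inter isOpen_interior)
    (fun x hx => mem_iUnion.2 ⟨x, hUp x, hKK' hx⟩)
  obtain ⟨f, hf⟩ := SmoothPartitionOfUnity.exists_isSubordinate (𝓡 n) hK.isClosed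
    (fun p : t => U p ∩ interior K') (fun p => (hUo p).inter isOpen_interior)
    (by simpa only [iUnion_subtype] using ht)
  have hfc : ∀ i, HasCompactSupport (f i) := fun i =>
    hK'.of_isClosed_subset (isClosed_tsupport _)
      ((hf i).trans (inter_subset_right.trans interior_subset))
  have hloc : ∀ i : t, _ := fun i => hφ.localized_divergence_le hX (hball i) Metric.isOpen_ball
    (hC i) (f i).contMDiff (fun x => f.nonneg i x) (hfc i) ((hf i).trans inter_subset_left)
    hψ hb hb0 hψb
  have hsum1 : ∀ x ∈ K, ∑ i, f i x = 1 := fun x hx => by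
    rw [← finsum_eq_sum_of_fintype]
    exact f.sum_eq_one hx
  -- the derivatives of the cutoffs cancel on the support of `ψ`
  have hpt : ∀ x, ψ x * (n * φ x)
      = ∑ i, ψ x * (n * φ x * f i x + mvfderiv (𝓡 n) (f i) x (X x)) := by
    intro x
    by_cases hx : x ∈ tsupport ψ
    swap
    · rw [image_eq_zero_of_notMem_tsupport hx]; simp
    have hint := hψK hx
    have hmd : ∀ i, MDifferentiableAt (𝓡 n) 𝓘(ℝ, ℝ) (f i) x := fun i =>
      ((f i).contMDiff x).mdifferentiableAt (by simp)
    have hder : ∀ s : Finset t, MDifferentiableAt (𝓡 n) 𝓘(ℝ, ℝ) (fun z => ∑ i ∈ s, f i z) x ∧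
        mvfderiv (𝓡 n) (fun z => ∑ i ∈ s, f i z) x (X x)
          = ∑ i ∈ s, mvfderiv (𝓡 n) (f i) x (X x) := by
      intro s
      induction s using Finset.induction_on with
      | empty =>
        simp only [Finset.sum_empty]
        exact ⟨mdifferentiableAt_const, by rw [mvfderiv_const]; rfl⟩
      | insert a s ha ih =>
        simp only [Finset.sum_insert ha]
        refine ⟨(hmd a).add ih.1, ?_⟩
        rw [← ih.2]
        exact DFunLike.congr_fun (mvfderiv_fun_add (hmd a) ih.1) (X x)
    have hzero : ∑ i, mvfderiv (𝓡 n) (f i) x (X x) = 0 := by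
      rw [← (hder Finset.univ).2]
      have he : (fun z => ∑ i, f i z) =ᶠ[𝓝 x] fun _ => 1 := by
        filter_upwards [isOpen_interior.mem_nhds hint] with z hz
        exact hsum1 z (interior_subset hz)
      have := he.mfderiv_eq (I := 𝓡 n) (I' := 𝓘(ℝ, ℝ))
      rw [mfderiv_const] at this
      exact DFunLike.congr_fun this (X x)
    rw [← Finset.mul_sum, Finset.sum_add_distrib, hzero, ← Finset.mul_sum,
      hsum1 x (interior_subset hint)]
    ring
  have hcont : ∀ i, Continuous fun x =>
      ψ x * (n * φ x * f i x + mvfderiv (𝓡 n) (f i) x (X x)) := fun i =>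
    hψ.continuous.mul
      (((continuous_const.mul (hφ.continuous hX)).mul (f i).contMDiff.continuous).add
      (continuous_mvfderiv_apply hX (f i).contMDiff))
  have hinteg : ∀ i, Integrable (fun x =>
      ψ x * (n * φ x * f i x + mvfderiv (𝓡 n) (f i) x (X x))) (riemannianVolume n M) := fun i =>
    (hcont i).integrable_of_hasCompactSupport hψc.mul_right
  have hmeas : ∀ i, Measurable fun x => ENNReal.ofReal (f i x * (b x * ‖X x‖)) := fun i =>
    ((f i).contMDiff.continuous.measurable.mul
      (hb.mul (continuous_norm_vectorField hX).measurable)).ennreal_ofReal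
  rw [integral_congr_ae (Eventually.of_forall hpt), integral_finsetSum _ fun i _ => hinteg i]
  refine (Finset.le_sum_of_subadditive ENNReal.ofReal ENNReal.ofReal_zero.le
    (fun _ _ => ENNReal.ofReal_add_le) _ _).trans ?_
  refine (Finset.sum_le_sum fun i _ => hloc i).trans ?_
  rw [← lintegral_finsetSum _ fun i _ => hmeas i]
  refine lintegral_mono fun x => ?_
  have hbx : 0 ≤ b x * ‖X x‖ := mul_nonneg (hb0 x) (norm_nonneg _)
  rw [← ENNReal.ofReal_sum_of_nonneg fun i _ => mul_nonneg (f.nonneg i x) hbx, ← Finset.sum_mul]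
  refine ENNReal.ofReal_le_ofReal (mul_le_of_le_one_left hbx ?_)
  rw [← finsum_eq_sum_of_fintype]
  exact f.sum_le_one x

end LocalDivergence

/-! ### Cutoffs and decay of tails -/

section Cutoff

variable {M : Type*} [MetricSpace M]

/-- The radial cutoff: `1` on the ball of radius `R` around `x₀`, `0` outside the ball of radius
`2 R`, and linear in the distance in between. -/
noncomputable def radialCutoff (x₀ : M) (R : ℝ) (x : M) : ℝ := max 0 (min 1 (2 - dist x x₀ / R))

theorem radialCutoff_nonneg (x₀ : M) (R : ℝ) (x : M) : 0 ≤ radialCutoff x₀ R x := le_max_left _ _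

theorem radialCutoff_eq_one {x₀ : M} {R : ℝ} (hR : 0 < R) {x : M} (hx : dist x x₀ ≤ R) :
    radialCutoff x₀ R x = 1 := by
  have h : dist x x₀ / R ≤ 1 := (div_le_one hR).2 hx
  rw [radialCutoff, min_eq_left (by linarith), max_eq_right zero_le_one]

theorem radialCutoff_eq_zero {x₀ : M} {R : ℝ} (hR : 0 < R) {x : M} (hx : 2 * R ≤ dist x x₀) :
    radialCutoff x₀ R x = 0 := by
  have h : 2 ≤ dist x x₀ / R := (le_div_iff₀ hR).2 hx
  rw [radialCutoff, max_eq_left ((min_le_right _ _).trans (by linarith))]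

theorem abs_radialCutoff_sub_le (x₀ : M) {R : ℝ} (hR : 0 < R) (x z : M) :
    |radialCutoff x₀ R z - radialCutoff x₀ R x| ≤ 1 / R * dist x z := by
  have h1 := abs_max_sub_max_le_abs (min 1 (2 - dist z x₀ / R)) (min 1 (2 - dist x x₀ / R)) 0
  rw [max_comm, max_comm _ (0 : ℝ)] at h1
  have h2 := abs_min_sub_min_le_max 1 (2 - dist z x₀ / R) 1 (2 - dist x x₀ / R)
  rw [sub_self, abs_zero, max_eq_right (abs_nonneg _)] at h2
  refine (h1.trans h2).trans ?_
  have h3 : 2 - dist z x₀ / R - (2 - dist x x₀ / R) = (dist x x₀ - dist z x₀) / R := by ring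
  rw [h3, abs_div, abs_of_pos hR, one_div, inv_mul_eq_div]
  exact div_le_div_of_nonneg_right (abs_dist_sub_le _ _ _) hR.le

theorem lipschitzWith_radialCutoff (x₀ : M) {R : ℝ} (hR : 0 < R) :
    LipschitzWith (Real.toNNReal (1 / R)) (radialCutoff x₀ R) := by
  refine LipschitzWith.of_dist_le_mul fun x z => ?_
  rw [Real.coe_toNNReal _ (one_div_nonneg.2 hR.le), Real.dist_eq, dist_comm x z]
  exact abs_radialCutoff_sub_le x₀ hR z x

theorem hasCompactSupport_radialCutoff [ProperSpace M] (x₀ : M) {R : ℝ} (hR : 0 < R) :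
    HasCompactSupport (radialCutoff x₀ R) :=
  HasCompactSupport.intro (isCompact_closedBall x₀ (2 * R)) fun _ hx =>
    radialCutoff_eq_zero hR (not_le.1 (mt Metric.mem_closedBall.2 hx)).le

/-- The local Lipschitz constant of the cutoff is at most `1 / R`, and vanishes off the annulus
`R ≤ d ≤ 2 R`. -/
theorem eventually_abs_radialCutoff_sub_le (x₀ : M) {R : ℝ} (hR : 0 < R) (x : M) :
    ∀ᶠ z in 𝓝 x, |radialCutoff x₀ R z - radialCutoff x₀ R x|
      ≤ {y | R ≤ dist y x₀ ∧ dist y x₀ ≤ 2 * R}.indicator (fun _ => 1 / R) x * dist x z := by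
  have hc : Continuous fun z : M => dist z x₀ := by fun_prop
  by_cases h1 : dist x x₀ < R
  · filter_upwards [hc.continuousAt.eventually_lt continuousAt_const h1] with z hz
    rw [radialCutoff_eq_one hR h1.le, radialCutoff_eq_one hR hz.le, sub_self, abs_zero]
    exact mul_nonneg (indicator_nonneg (fun _ _ => one_div_nonneg.2 hR.le) _) dist_nonneg
  by_cases h2 : 2 * R < dist x x₀
  · filter_upwards [continuousAt_const.eventually_lt hc.continuousAt h2] with z hz
    rw [radialCutoff_eq_zero hR h2.le, radialCutoff_eq_zero hR hz.le, sub_self, abs_zero]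
    exact mul_nonneg (indicator_nonneg (fun _ _ => one_div_nonneg.2 hR.le) _) dist_nonneg
  · have hx : x ∈ {y | R ≤ dist y x₀ ∧ dist y x₀ ≤ 2 * R} := ⟨not_lt.1 h1, not_lt.1 h2⟩
    rw [indicator_of_mem hx]
    exact Eventually.of_forall fun z => abs_radialCutoff_sub_le x₀ hR x z

/-- The tails of a convergent integral tend to zero. -/
theorem tendsto_setLIntegral_compl_ball [MeasurableSpace M] [BorelSpace M] {μ : Measure M}
    {f : M → ℝ≥0∞} (x₀ : M) (r : ℝ) (hf : ∫⁻ x in (Metric.ball x₀ r)ᶜ, f x ∂μ < ⊤) :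
    Tendsto (fun k : ℕ => ∫⁻ x in (Metric.ball x₀ (k : ℝ))ᶜ, f x ∂μ) atTop (𝓝 0) := by
  set ν := (μ.restrict (Metric.ball x₀ r)ᶜ).withDensity f with hν
  have hm : ∀ s : ℝ, MeasurableSet (Metric.ball x₀ s)ᶜ := fun s => measurableSet_ball.compl
  have happ : ∀ k : ℕ, r ≤ k → ν (Metric.ball x₀ (k : ℝ))ᶜ
      = ∫⁻ x in (Metric.ball x₀ (k : ℝ))ᶜ, f x ∂μ := fun k hk => by
    rw [hν, withDensity_apply _ (hm k), Measure.restrict_restrict (hm k),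
      inter_eq_left.2 (compl_subset_compl.2 (Metric.ball_subset_ball hk))]
  have hfin : ν univ < ⊤ := by
    rwa [hν, withDensity_apply _ MeasurableSet.univ, Measure.restrict_univ]
  have hanti : Antitone fun k : ℕ => (Metric.ball x₀ (k : ℝ))ᶜ := fun i j hij =>
    compl_subset_compl.2 (Metric.ball_subset_ball (Nat.cast_le.2 hij))
  have hempty : ⋂ k : ℕ, (Metric.ball x₀ (k : ℝ))ᶜ = ∅ := by
    rw [← compl_iUnion, Metric.iUnion_ball_nat, compl_univ]
  have h := tendsto_measure_iInter_atTop (μ := ν) (fun k : ℕ => (hm k).nullMeasurableSet) hanti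
    ⟨0, ((measure_mono (subset_univ _)).trans_lt hfin).ne⟩
  rw [hempty, measure_empty] at h
  refine h.congr' ?_
  filter_upwards [eventually_ge_atTop ⌈r⌉₊] with k hk
  exact happ k (Nat.ceil_le.1 hk)

end Cutoff

/-! ### Vanishing of the conformal factor -/

section Triviality

variable {n : ℕ} {M : Type*} [MetricSpace M] [ChartedSpace (EuclideanSpace ℝ (Fin n)) M]
  [IsManifold (𝓡 n) ∞ M] [RiemannianBundle (fun x : M => TangentSpace (𝓡 n) x)]

theorem IsConformalField.nonneg [NeZero n]
    [IsContMDiffRiemannianBundle (𝓡 n) ∞ (EuclideanSpace ℝ (Fin n))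
      (fun x : M => TangentSpace (𝓡 n) x)]
    {X : Π x : M, TangentSpace (𝓡 n) x} {φ : M → ℝ}
    (hφ : IsConformalField X φ) (hLie : LieDerivMetricNonneg X) (x : M) : 0 ≤ φ x := by
  have hy := mem_extChartAt_target (I := 𝓡 n) x
  obtain ⟨Y, hY, hYe⟩ := exists_smooth_extension_const hy (EuclideanSpace.single 0 (1 : ℝ))
  have hYx := hYe.self_of_nhds
  have hpos : 0 < metricMatrix x (extChartAt (𝓡 n) x x) (0 : Fin n) 0 :=
    (metricMatrix_posDef x hy).diag_pos
  have h2 : metricMatrix x (extChartAt (𝓡 n) x x) (0 : Fin n) 0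
      = inner ℝ (Y ((extChartAt (𝓡 n) x).symm (extChartAt (𝓡 n) x x)))
        (Y ((extChartAt (𝓡 n) x).symm (extChartAt (𝓡 n) x x))) := by
    rw [hYx]; rfl
  have h := hφ Y Y hY hY ((extChartAt (𝓡 n) x).symm (extChartAt (𝓡 n) x x))
  have h0 := hLie Y hY ((extChartAt (𝓡 n) x).symm (extChartAt (𝓡 n) x x))
  rw [← h2] at h
  have h3 : 0 ≤ φ ((extChartAt (𝓡 n) x).symm (extChartAt (𝓡 n) x x)) :=
    nonneg_of_mul_nonneg_left (by rw [← h]; linarith) hpos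
  rwa [extChartAt_to_inv] at h3

/-- On a complete manifold, a conformal field `X` with nonnegative factor whose norm satisfies
`∫ |X| / d < ∞` near infinity has factor zero. -/
theorem IsConformalField.eq_zero [NeZero n] [SecondCountableTopology M]
    [IsContMDiffRiemannianBundle (𝓡 n) ∞ (EuclideanSpace ℝ (Fin n))
      (fun x : M => TangentSpace (𝓡 n) x)]
    [IsRiemannianManifold (𝓡 n) M] [MeasurableSpace M] [BorelSpace M] [CompleteSpace M]
    {X : Π x : M, TangentSpace (𝓡 n) x} {φ : M → ℝ}
    (hφ : IsConformalField X φ) (hX : IsSmoothVectorField X) (hφ0 : ∀ x, 0 ≤ φ x)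
    (x₀ : M) (r : ℝ)
    (hint : ∫⁻ x in (Metric.ball x₀ r)ᶜ, ENNReal.ofReal (‖X x‖ / dist x x₀)
      ∂(riemannianVolume n M) < ⊤) (x : M) : φ x = 0 := by
  have : ProperSpace M := properSpace_of_isRiemannianManifold n M
  have hn : (0 : ℝ) < n := Nat.cast_pos.2 (NeZero.pos n)
  have hφc := hφ.continuous hX
  have hnφ0 : ∀ x, 0 ≤ n * φ x := fun x => mul_nonneg hn.le (hφ0 x)
  have hdist : Measurable fun x : M => dist x x₀ := (continuous_id.dist continuous_const).measurable
  have hnorm := (continuous_norm_vectorField hX).measurable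
  have htail := tendsto_setLIntegral_compl_ball x₀ r hint
  -- testing against the cutoff of radius `R` bounds `∫ φ` over the ball by a tail
  have hball : ∀ R : ℝ, 0 < R →
      ∫⁻ x in Metric.ball x₀ R, ENNReal.ofReal (n * φ x) ∂(riemannianVolume n M)
        ≤ 2 * ∫⁻ x in (Metric.ball x₀ R)ᶜ, ENNReal.ofReal (‖X x‖ / dist x x₀)
          ∂(riemannianVolume n M) := by
    intro R hR
    have hann : MeasurableSet {y : M | R ≤ dist y x₀ ∧ dist y x₀ ≤ 2 * R} :=
      (measurableSet_le measurable_const hdist).inter (measurableSet_le hdist measurable_const)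
    have key := hφ.integral_mul_le hX (lipschitzWith_radialCutoff x₀ hR)
      (hasCompactSupport_radialCutoff x₀ hR) (measurable_const.indicator hann)
      (fun x => indicator_nonneg (fun _ _ => one_div_nonneg.2 hR.le) x)
      (eventually_abs_radialCutoff_sub_le x₀ hR)
    have hinteg : Integrable (fun x => radialCutoff x₀ R x * (n * φ x)) (riemannianVolume n M) :=
      ((lipschitzWith_radialCutoff x₀ hR).continuous.mul
        (continuous_const.mul hφc)).integrable_of_hasCompactSupport
          (hasCompactSupport_radialCutoff x₀ hR).mul_right
    rw [ofReal_integral_eq_lintegral_ofReal hinteg (Eventually.of_forall fun x =>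
      mul_nonneg (radialCutoff_nonneg x₀ R x) (hnφ0 x))] at key
    rw [← lintegral_indicator measurableSet_ball, ← lintegral_const_mul _ (by fun_prop)]
    refine le_trans (lintegral_mono fun x => ?_) (key.trans ?_)
    · by_cases hx : x ∈ Metric.ball x₀ R
      · rw [indicator_of_mem hx, radialCutoff_eq_one hR (Metric.mem_ball.1 hx).le, one_mul]
      · rw [indicator_of_notMem hx]
        exact zero_le
    · rw [← lintegral_indicator measurableSet_ball.compl]
      refine lintegral_mono fun x => ?_
      by_cases hx : x ∈ {y : M | R ≤ dist y x₀ ∧ dist y x₀ ≤ 2 * R}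
      swap
      · simp only [indicator_of_notMem hx, zero_mul, ENNReal.ofReal_zero, zero_le]
      have hxb : x ∈ (Metric.ball x₀ R)ᶜ := fun h => not_lt.2 hx.1 (Metric.mem_ball.1 h)
      have hd : 0 < dist x x₀ := hR.trans_le hx.1
      have hle : 1 / R * ‖X x‖ ≤ 2 * (‖X x‖ / dist x x₀) := by
        rw [mul_div_assoc', one_div, inv_mul_eq_div, div_le_div_iff₀ hR hd]
        nlinarith [hx.2, norm_nonneg (X x)]
      rw [indicator_of_mem hxb, indicator_of_mem hx]
      refine (ENNReal.ofReal_le_ofReal hle).trans_eq ?_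
      rw [ENNReal.ofReal_mul zero_le_two]
      congr 1
      exact ENNReal.ofReal_ofNat 2
  have hzero : ∀ m : ℕ,
      ∫⁻ x in Metric.ball x₀ (m : ℝ), ENNReal.ofReal (n * φ x) ∂(riemannianVolume n M) = 0 := by
    intro m
    have h2 := ENNReal.Tendsto.const_mul (a := 2) htail (Or.inr ENNReal.ofNat_ne_top)
    rw [mul_zero] at h2
    refine le_antisymm (ge_of_tendsto h2 ?_) zero_le
    filter_upwards [eventually_ge_atTop m, eventually_gt_atTop 0] with k hk hk0
    exact (lintegral_mono_set (Metric.ball_subset_ball (Nat.cast_le.2 hk))).trans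
      (hball k (Nat.cast_pos.2 hk0))
  by_contra hne
  have hxpos : 0 < φ x := lt_of_le_of_ne (hφ0 x) (Ne.symm hne)
  obtain ⟨m, hm⟩ := exists_nat_gt (dist x x₀)
  have hopen : IsOpen (Metric.ball x₀ (m : ℝ) ∩ {z | 0 < φ z}) :=
    Metric.isOpen_ball.inter (isOpen_lt continuous_const hφc)
  refine (riemannianVolume_pos_of_isOpen (n := n) hopen ⟨x, Metric.mem_ball.2 hm, hxpos⟩).ne' ?_
  have hae := (lintegral_eq_zero_iff
    (continuous_const.mul hφc).measurable.ennreal_ofReal).1 (hzero m)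
  rw [EventuallyEq, ae_restrict_iff' measurableSet_ball, ae_iff] at hae
  refine measure_mono_null (fun z hz => ?_) hae
  exact fun h => not_lt.2 (ENNReal.ofReal_eq_zero.1 (h hz.1)) (mul_pos hn hz.2)

end Triviality

theorem theorem2 {n : ℕ} (hn : 3 ≤ n) {M : Type*} [MetricSpace M] [SecondCountableTopology M]
    [ChartedSpace (EuclideanSpace ℝ (Fin n)) M] [IsManifold (𝓡 n) ∞ M]
    [RiemannianBundle (fun x : M => TangentSpace (𝓡 n) x)]
    [IsContMDiffRiemannianBundle (𝓡 n) ∞ (EuclideanSpace ℝ (Fin n))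
      (fun x : M => TangentSpace (𝓡 n) x)]
    [IsRiemannianManifold (𝓡 n) M] [MeasurableSpace M] [BorelSpace M]
    [CompleteSpace M] [NoncompactSpace M]
    (k l : ℕ) (hk : k ≤ n) (hl : l ≤ n)
    (X : Π x : M, TangentSpace (𝓡 n) x) (lam : M → ℝ)
    (hsol : IsQuotientAlmostYamabeSoliton k l X lam)
    (x₀ : M) (r : ℝ) (hr : 0 < r)
    (hint : ∫⁻ x in (Metric.ball x₀ r)ᶜ, ENNReal.ofReal (‖X x‖ / dist x x₀)
      ∂(riemannianVolume n M) < ⊤)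
    (hLie : LieDerivMetricNonneg X) :
    IsTrivialSoliton k l X lam := by
  have : NeZero n := ⟨by omega⟩
  have hφ : IsConformalField X
      fun x => Real.log (sigmaCurv n k x / sigmaCurv n l x) - lam x := hsol.equation
  have hzero := hφ.eq_zero hsol.smooth_field (hφ.nonneg hLie) x₀ r hint
  refine ⟨fun Y Z hY hZ x => ?_, hzero⟩
  have h := hφ Y Z hY hZ x
  simp only [hzero x, zero_mul] at h
  linarith
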